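/- **Conventions.** For $0<q\le\infty$ put $1/\infty=0$. For a measurable $f:[0,1]\to\mathbb C$ let $f^*(t)=\inf\{s\ge 0: |\{x\in[0,1]:|f(x)|>s\}|\le t\}$, and for a family $c=\{c_n\}_{n\in I}$ of complex numbers let $c_k^*=\inf\{s\ge0:\#\{n:|c_n|>s\}\le k-1\}$, $k=1,2,\dots$ ($\inf\emptyset=\infty$). For $0<p,q\le\infty$ and $\beta\in\mathbb R$ let $L_{p,q}(\log L)_\beta$ be the space of (classes of) measurable functions $f$ on $[0,1]$ with $$\|f\|_{L_{p,q}(\log L)_\beta}:=\big\|t^{1/p-1/q}(1+|\log t|)^\beta f^*(t)\big\|_{L_q(0,1)}<\infty,$$ and let $l_{p,q}(\log l)_\beta$ be the space of families $c$ with $$\|c\|_{l_{p,q}(\log l)_\beta}:=\big\|\{k^{1/p-1/q}(1+\log k)^\beta c_k^*\}_{k\ge1}\big\|_{l_q}<\infty.$$ The intersection of two such spaces carries the maximum of the two quasi-norms. Let $I$ be a countably infinite index set (for instance $\mathbb N$ or $\mathbb Z$), let $\{\varphi_n\}_{n\in I}$ be an orthonormal system in $L_2[0,1]$ with $M:=\sup_n\|\varphi_n\|_{L_\infty}<\infty$,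 and let $\mathcal F^{-1}c:=\sum_{n\in I} c_n\varphi_n$ (unconditional convergence in $L_2$). **Corollary 4.2.** Let $0<q\le\infty$, $\alpha>-1/q$ and $\varepsilon>0$. There is a constant $C>0$, depending only on $q$, $\alpha$ and $\varepsilon$, such that for every such system and every $c\in l_{2,q}(\log l)_{\alpha+1/\min(q,2)}$ the series $\sum_n c_n\varphi_n$ converges unconditionally in $L_2$, its sum $\mathcal F^{-1}c$ belongs to $L_{2,q}(\log L)_{\alpha+1/\max(q,2)}\cap L_{2,\max(q,2)}(\log L)_{\alpha+1/q}$, and $$\big\|\mathcal F^{-1}c\big\|_{L_{2,q}(\log L)_{\alpha+1/\max(q,2)}\cap L_{2,\max(q,2)}(\log L)_{\alpha+1/q}}\le C\,\min\!\big(M,(1+\log M)^{|\alpha+\varepsilon+1/q|}\big)\,\|c\|_{l_{2,q}(\log l)_{\alpha+1/\min(q,2)}}.$$ In particular, if $\alpha>-1/2$ and $\varepsilon>0$, there is a constant $C>0$, depending only on $\alpha$ and $\varepsilon$, such that for every such system and every $c\in l_{2,2}(\log l)_{\alpha+1/2}$ the series converges unconditionally in $L_2$, $\mathcal F^{-1}c\in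 L_{2,2}(\log L)_{\alpha+1/2}$, and $$\big\|\mathcal F^{-1}c\big\|_{L_{2,2}(\log L)_{\alpha+1/2}}\le C\,\min\!\big(M,(1+\log M)^{|\alpha+\varepsilon+1/2|}\big)\,\|c\|_{l_{2,2}(\log l)_{\alpha+1/2}}.$$ -/

import Mathlib

open MeasureTheory Set
open scoped ENNReal

noncomputable section

/-- Lebesgue measure on the interval `[0, 1]`. -/
abbrev volI : Measure ℝ := volume.restrict (Icc 0 1)

/-- The real number `1 / q` attached to `0 < q ≤ ∞`, with `1 / ∞ = 0`. -/
def recip (q : ℝ≥0∞) : ℝ := (q⁻¹).toReal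

/-- The non-increasing rearrangement `f^*(t) = inf {s : |{x ∈ [0,1] : |f x| > s}| ≤ t}` of a
function on `[0, 1]`. -/
def funRearr (f : ℝ → ℂ) (t : ℝ) : ℝ≥0∞ :=
  sInf {s : ℝ≥0∞ | volI {x | s < ‖f x‖ₑ} ≤ ENNReal.ofReal t}

/-- The non-increasing rearrangement of a family `c` of complex numbers. The numbering starts at
zero: `seqRearr c k` is the `(k + 1)`-st term `c^*_{k+1} = inf {s : #{n : |c n| > s} ≤ k}`. -/
def seqRearr {ι : Type*} (c : ι → ℂ) (k : ℕ) : ℝ≥0∞ :=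
  sInf {s : ℝ≥0∞ | {n | s < ‖c n‖ₑ}.encard ≤ k}

/-- The quasi-norm of the Lorentz–Zygmund function space `L_{p,q}(log L)_β` (`0 < p, q ≤ ∞`):
the `L_q(0,1)` quasi-norm of `t^{1/p-1/q} (1 + |log t|)^β f^*(t)`. -/
def funLZNorm (p q : ℝ≥0∞) (β : ℝ) (f : ℝ → ℂ) : ℝ≥0∞ :=
  eLpNorm (fun t : ℝ =>
      ENNReal.ofReal (t ^ (recip p - recip q) * (1 + |Real.log t|) ^ β) * funRearr f t)
    q (volume.restrict (Ioo 0 1))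

/-- The quasi-norm of the Lorentz–Zygmund sequence space `l_{p,q}(log l)_β` (`0 < p, q ≤ ∞`):
the `l_q` quasi-norm of `k^{1/p-1/q} (1 + log k)^β c^*_k`, `k = 1, 2, …` (here `k` is written
`k + 1` with `k : ℕ`; the `l_q` quasi-norm is the `L_q` one for the counting measure). -/
def seqLZNorm {ι : Type*} (p q : ℝ≥0∞) (β : ℝ) (c : ι → ℂ) : ℝ≥0∞ :=
  eLpNorm (fun k : ℕ =>
      ENNReal.ofReal (((k : ℝ) + 1) ^ (recip p - recip q) * (1 + Real.log ((k : ℝ) + 1)) ^ β)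
        * seqRearr c k)
    q Measure.count

/-- The Lorentz–Zygmund function space `L_{p,q}(log L)_β` on `[0, 1]`. -/
def funLZ (p q : ℝ≥0∞) (β : ℝ) : Set (ℝ → ℂ) :=
  {f | AEStronglyMeasurable f volI ∧ funLZNorm p q β f < ∞}

/-- The Lorentz–Zygmund sequence space `l_{p,q}(log l)_β` over the index set `ι`. -/
def seqLZ (ι : Type*) (p q : ℝ≥0∞) (β : ℝ) : Set (ι → ℂ) :=
  {c | seqLZNorm p q β c < ∞}

/-- The inverse Fourier map `{c_n} ↦ ∑ c_n φ_n`, the series being summed in `L_2`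
(this is only meaningful for `c` such that the series converges in `L_2`). -/
def invFourier {ι : Type*} (φ : ι → Lp ℂ 2 volI) (c : ι → ℂ) : Lp ℂ 2 volI :=
  ∑' n, c n • φ n

end

/-! Write f for the sum of the series, `a j = 2^{j/2} c^*_{2^j}` (`seqDyadic`) and `F j = 2^{-j/2}
f^*(2^{-j})` (`funDyadic`). For p = 2 the Lorentz–Zygmund quasi-norms are controlled through `l_q`
norms of `(j+1)^b a j` and `(j+1)^b F j`: the logarithmic weight has become a power of `j`. Now
group the `j` into blocks `2^l ≤ j+1 < 2^(l+1)` and take `l_2` norms over each block. The power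
weight becomes exponential in `l`, and exchanging `l_q` for `l_2` on `2^l` points costs exactly the
shifts `1/min(q,2)` and `1/max(q,2)`. The source norm and both target norms thus reduce to block
norms with the single weight `2^{δl}`, `δ = α + 1/q > 0`.

The analytic input is `orthonormal_series_dyadic_le`. Cut c at the level `c^*_{2^J}`. The small
coefficients give a function controlled in `L_2` by orthonormality, the large ones a function
bounded by `M` times an `l_1` sum. Hence the square tail of `F` from `j` is at most the square tail
of `a` from `J` plus a multiple of `2^{-j} M^2 (∑_{i<J} 2^{i/2} a i)^2`.

Let `T l` be the square root of the sum of squared block norms of `a` from block `l` on. Taking `J`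
and `j` at the starts of consecutive blocks makes the error `M^2 2^{-2^l} (T 0)^2`, while `J = 0`
gives the error-free bound `8 (T 0)^2`. The smaller of the two is at most a multiple of `((1 + log
M) 2^{-l})^{2γ} (T 0)^2` for any `γ > 0` (`min_one_sq_mul_two_rpow_le`). With `γ = δ + ε` the
weighted error is geometric in `l`, and the main term is handled by a Hardy inequality
(`eLpNorm_weighted_tail_le`), which needs only `δ > 0`. Finally `M ≥ 1`, so `(1 + log M)^γ` is
dominated by a multiple of `M`, and the minimum in the statement costs only a constant. -/

/-! ### `L_q` and `l_q` quasi-norms of nonnegative functions, for all exponents -/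

theorem eLpNorm_restrict_iUnion_eq {X : Type*} [MeasurableSpace X] {μ : Measure X}
    {S : ℕ → Set X} (hS : ∀ j, MeasurableSet (S j)) (hd : Pairwise (Function.onFun Disjoint S))
    (y : X → ℝ≥0∞) (q : ℝ≥0∞) :
    eLpNorm y q (μ.restrict (⋃ j, S j)) =
      eLpNorm (fun j => eLpNorm y q (μ.restrict (S j))) q Measure.count := by
  rcases eq_or_ne q 0 with rfl | h0
  · simp
  rcases eq_or_ne q ∞ with rfl | ht
  · simp only [eLpNorm_exponent_top, eLpNormEssSup_count, enorm_eq_self]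
    apply le_antisymm
    · refine essSup_le_of_ae_le _ ?_
      rw [Filter.EventuallyLE, ae_restrict_iUnion_iff]
      intro j
      filter_upwards [ae_le_eLpNormEssSup (f := y) (μ := μ.restrict (S j))] with x hx
      exact hx.trans (le_iSup (fun j => eLpNormEssSup y (μ.restrict (S j))) j)
    · exact iSup_le fun j =>
        eLpNormEssSup_mono_measure _ (Measure.absolutelyContinuous_of_le
          (Measure.restrict_mono (subset_iUnion S j) le_rfl))
  · have hq : 0 < q.toReal := ENNReal.toReal_pos h0 ht
    simp only [eLpNorm_eq_lintegral_rpow_enorm_toReal h0 ht, lintegral_iUnion hS hd,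
      lintegral_count, enorm_eq_self]
    congr 1
    refine tsum_congr fun j => ?_
    rw [← ENNReal.rpow_mul, one_div, inv_mul_cancel₀ hq.ne', ENNReal.rpow_one]

theorem eLpNorm_const_mul_ennreal {X : Type*} [MeasurableSpace X] {μ : Measure X}
    (y : X → ℝ≥0∞) (q : ℝ≥0∞) {c : ℝ≥0∞} (hc : c ≠ ∞) :
    eLpNorm (fun x => c * y x) q μ = c * eLpNorm y q μ := by
  rcases eq_or_ne q 0 with rfl | h0
  · simp
  rcases eq_or_ne q ∞ with rfl | ht
  · simp only [eLpNorm_exponent_top, eLpNormEssSup, enorm_eq_self]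
    exact ENNReal.essSup_const_mul
  · have hq : 0 < q.toReal := ENNReal.toReal_pos h0 ht
    simp only [eLpNorm_eq_lintegral_rpow_enorm_toReal h0 ht, enorm_eq_self]
    simp_rw [ENNReal.mul_rpow_of_nonneg _ _ hq.le]
    rw [lintegral_const_mul' _ _ (ENNReal.rpow_ne_top_of_nonneg hq.le hc),
      ENNReal.mul_rpow_of_nonneg _ _ (by positivity), ← ENNReal.rpow_mul, one_div,
      mul_inv_cancel₀ hq.ne', ENNReal.rpow_one]

theorem eLpNorm_le_const_mul {X : Type*} [MeasurableSpace X] {μ : Measure X}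
    {x y : X → ℝ≥0∞} (q : ℝ≥0∞) {c : ℝ≥0∞} (hc : c ≠ ∞) (h : ∀ i, x i ≤ c * y i) :
    eLpNorm x q μ ≤ c * eLpNorm y q μ := by
  rw [← eLpNorm_const_mul_ennreal y q hc]
  exact eLpNorm_mono_enorm fun i => by simpa using h i

/-- Each term is at most the `l_p` norm `N`, so `x^q ≤ N^(q-p) x^p` termwise. -/
theorem eLpNorm_count_le_of_exponent_le {p q : ℝ≥0∞} (hp : p ≠ 0) (hpq : p ≤ q) (x : ℕ → ℝ≥0∞) :
    eLpNorm x q Measure.count ≤ eLpNorm x p Measure.count := by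
  set N := eLpNorm x p Measure.count with hN
  have hx : ∀ i, x i ≤ N := fun i => by
    simpa using enorm_le_eLpNorm_count x i hp
  rcases eq_or_ne q ∞ with rfl | ht
  · simpa [eLpNorm_exponent_top] using hx
  have hpt : p ≠ ∞ := fun h => ht (top_le_iff.1 (h ▸ hpq))
  have hq0 : q ≠ 0 := fun h => hp (nonpos_iff_eq_zero.1 (h ▸ hpq))
  have hp' : 0 < p.toReal := ENNReal.toReal_pos hp hpt
  have hq' : 0 < q.toReal := ENNReal.toReal_pos hq0 ht
  have hle : p.toReal ≤ q.toReal := ENNReal.toReal_mono ht hpq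
  rw [eLpNorm_eq_lintegral_rpow_enorm_toReal hq0 ht, lintegral_count]
  have hNp : ∑' i, x i ^ p.toReal = N ^ p.toReal := by
    rw [hN, eLpNorm_eq_lintegral_rpow_enorm_toReal hp hpt, lintegral_count, ← ENNReal.rpow_mul,
      one_div, inv_mul_cancel₀ hp'.ne', ENNReal.rpow_one]
    simp
  have h1 : ∑' i, ‖x i‖ₑ ^ q.toReal ≤ N ^ q.toReal := by
    calc ∑' i, ‖x i‖ₑ ^ q.toReal
        = ∑' i, x i ^ (q.toReal - p.toReal) * x i ^ p.toReal := by
          refine tsum_congr fun i => ?_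
          rw [← ENNReal.rpow_add_of_nonneg _ _ (by linarith) hp'.le]
          simp
      _ ≤ ∑' i, N ^ (q.toReal - p.toReal) * x i ^ p.toReal := by
          refine ENNReal.tsum_le_tsum fun i => ?_
          gcongr ?_ * _
          exact ENNReal.rpow_le_rpow (hx i) (by linarith)
      _ = N ^ q.toReal := by
          rw [ENNReal.tsum_mul_left, hNp, ← ENNReal.rpow_add_of_nonneg _ _ (by linarith) hp'.le]
          simp
  calc _ ≤ (N ^ q.toReal) ^ (1 / q.toReal) := by gcongr
    _ = N := by rw [← ENNReal.rpow_mul, one_div, mul_inv_cancel₀ hq'.ne', ENNReal.rpow_one]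

theorem eLpNorm_count_restrict_le_of_exponent_le {p q : ℝ≥0∞} (hp : p ≠ 0) (hpq : p ≤ q)
    (x : ℕ → ℝ≥0∞) (B : Set ℕ) :
    eLpNorm x q (Measure.count.restrict B) ≤ eLpNorm x p (Measure.count.restrict B) := by
  have hB : MeasurableSet B := .of_discrete
  rw [← eLpNorm_indicator_eq_eLpNorm_restrict hB, ← eLpNorm_indicator_eq_eLpNorm_restrict hB]
  exact eLpNorm_count_le_of_exponent_le hp hpq _

/-- Comparison of `ℓ_p` and `ℓ_q` norms on a set of at least one point, for all exponents. -/
theorem eLpNorm_count_restrict_le_mul {p q : ℝ≥0∞} (hq : q ≠ 0)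
    (x : ℕ → ℝ≥0∞) (B : Set ℕ) :
    eLpNorm x p (Measure.count.restrict B) ≤
      (Measure.count B) ^ (recip p - recip (max p q)) *
        eLpNorm x q (Measure.count.restrict B) := by
  rcases le_total p q with h | h
  · rw [max_eq_right h]
    have := eLpNorm_le_eLpNorm_mul_rpow_measure_univ (μ := Measure.count.restrict B) (f := x) h
      (Measurable.of_discrete.aestronglyMeasurable)
    rw [mul_comm]
    simpa [recip] using this
  · rw [max_eq_left h, sub_self, ENNReal.rpow_zero, one_mul]
    exact eLpNorm_count_restrict_le_of_exponent_le hq h x B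

/-! ### Hardy-type inequalities with geometric factors -/

/-- For finite `q` the `q`-th power of a supremum is at most the sum of the `q`-th powers. No
triangle inequality is needed, so `q < 1` is covered as well. -/
theorem eLpNorm_iSup_shift_le {r : ℝ≥0∞} (hr : r < 1) {q : ℝ≥0∞} (hq : q ≠ 0) :
    ∃ C : ℝ≥0∞, C ≠ ∞ ∧ ∀ D : ℕ → ℝ≥0∞,
      eLpNorm (fun l => ⨆ d : ℕ, r ^ d * D (l + d)) q Measure.count ≤
        C * eLpNorm D q Measure.count := by
  rcases eq_or_ne q ∞ with rfl | ht
  · refine ⟨1, by simp, fun D => ?_⟩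
    simp only [eLpNorm_exponent_top, eLpNormEssSup_count, enorm_eq_self, one_mul]
    refine iSup_le fun l => iSup_le fun d => ?_
    calc r ^ d * D (l + d) ≤ 1 * D (l + d) := by gcongr; exact pow_le_one' hr.le d
      _ ≤ _ := by rw [one_mul]; exact le_iSup D (l + d)
  have hq' : 0 < q.toReal := ENNReal.toReal_pos hq ht
  set s := q.toReal
  have hrs : r ^ s < 1 := ENNReal.rpow_lt_one hr hq'
  refine ⟨((1 - r ^ s)⁻¹) ^ (1 / s), ?_, fun D => ?_⟩
  · refine ENNReal.rpow_ne_top_of_nonneg (by positivity) ?_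
    rw [ENNReal.inv_ne_top]
    exact (tsub_pos_of_lt hrs).ne'
  simp only [eLpNorm_eq_lintegral_rpow_enorm_toReal hq ht, lintegral_count, enorm_eq_self]
  rw [← ENNReal.mul_rpow_of_nonneg _ _ (by positivity)]
  refine ENNReal.rpow_le_rpow ?_ (by positivity)
  calc ∑' l, (⨆ d : ℕ, r ^ d * D (l + d)) ^ s
      ≤ ∑' l, ∑' d : ℕ, (r ^ s) ^ d * D (l + d) ^ s := by
        refine ENNReal.tsum_le_tsum fun l => ?_
        rw [← ENNReal.le_rpow_inv_iff hq']
        refine iSup_le fun d => ?_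
        rw [ENNReal.le_rpow_inv_iff hq', ENNReal.mul_rpow_of_nonneg _ _ hq'.le]
        refine le_trans (le_of_eq ?_) (ENNReal.le_tsum d)
        rw [← ENNReal.rpow_natCast, ← ENNReal.rpow_natCast, ← ENNReal.rpow_mul,
          ← ENNReal.rpow_mul, mul_comm s]
    _ = ∑' d : ℕ, (r ^ s) ^ d * ∑' l, D (l + d) ^ s := by
        rw [ENNReal.tsum_comm]
        simp_rw [ENNReal.tsum_mul_left]
    _ ≤ ∑' d : ℕ, (r ^ s) ^ d * ∑' l, D l ^ s := by
        refine ENNReal.tsum_le_tsum fun d => ?_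
        refine mul_le_mul_right ?_ _
        exact ENNReal.tsum_comp_le_tsum_of_injective (add_left_injective d) (fun l => D l ^ s)
    _ = _ := by rw [ENNReal.tsum_mul_right, ENNReal.tsum_geometric]

theorem eLpNorm_geometric_ne_top {r : ℝ≥0∞} (hr : r < 1) {q : ℝ≥0∞} (hq : q ≠ 0) :
    eLpNorm (fun l : ℕ => r ^ l) q Measure.count ≠ ∞ := by
  rcases eq_or_ne q ∞ with rfl | ht
  · simp only [eLpNorm_exponent_top, eLpNormEssSup_count, enorm_eq_self]
    exact ne_top_of_le_ne_top ENNReal.one_ne_top (iSup_le fun l => pow_le_one' hr.le l)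
  have hq' : 0 < q.toReal := ENNReal.toReal_pos hq ht
  simp only [eLpNorm_eq_lintegral_rpow_enorm_toReal hq ht, lintegral_count, enorm_eq_self]
  refine ENNReal.rpow_ne_top_of_nonneg (by positivity) ?_
  have : ∀ l : ℕ, (r ^ l) ^ q.toReal = (r ^ q.toReal) ^ l := fun l => by
    rw [← ENNReal.rpow_natCast, ← ENNReal.rpow_natCast, ← ENNReal.rpow_mul,
          ← ENNReal.rpow_mul, mul_comm]
  simp_rw [this, ENNReal.tsum_geometric]
  rw [ENNReal.inv_ne_top]
  exact (tsub_pos_of_lt (ENNReal.rpow_lt_one hr hq')).ne'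

theorem two_rpow_neg_lt_one {δ : ℝ} (hδ : 0 < δ) : (2 : ℝ≥0∞) ^ (-δ) < 1 :=
  ENNReal.rpow_lt_one_of_one_lt_of_neg (by norm_num) (by linarith)

theorem two_rpow_mul_pow (a : ℝ) (d : ℕ) : (2 : ℝ≥0∞) ^ (a * d) = ((2 : ℝ≥0∞) ^ a) ^ d := by
  rw [ENNReal.rpow_mul, ENNReal.rpow_natCast]

theorem two_rpow_add (a b : ℝ) : (2 : ℝ≥0∞) ^ (a + b) = 2 ^ a * 2 ^ b :=
  ENNReal.rpow_add _ _ (by norm_num) (by norm_num)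

/-- Weighted Hardy inequality for square tails, with an exponentially growing weight. -/
theorem eLpNorm_weighted_tail_le {δ : ℝ} (hδ : 0 < δ) {q : ℝ≥0∞} (hq : q ≠ 0) :
    ∃ C : ℝ≥0∞, C ≠ ∞ ∧ ∀ A : ℕ → ℝ≥0∞,
      eLpNorm (fun l : ℕ => (2 : ℝ≥0∞) ^ (δ * l) * (∑' d : ℕ, A (l + d) ^ 2) ^ (1 / 2 : ℝ)) q
        Measure.count ≤
        C * eLpNorm (fun l : ℕ => (2 : ℝ≥0∞) ^ (δ * l) * A l) q Measure.count := by
  -- The decay `2^{-δd}` is split in two: one factor `r^d` goes into the supremum `W`, the other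
  -- makes the sum of squares geometric.
  have hr1 := two_rpow_neg_lt_one (half_pos hδ)
  set r : ℝ≥0∞ := 2 ^ (-(δ / 2)) with hr
  obtain ⟨C, hC, h⟩ := eLpNorm_iSup_shift_le hr1 hq
  have hr2 : r ^ 2 < 1 := pow_lt_one₀ (by simp) hr1 (by norm_num)
  have hS : ((1 - r ^ 2)⁻¹) ≠ ∞ := by
    rw [ENNReal.inv_ne_top]; exact (tsub_pos_of_lt hr2).ne'
  have hS' : ((1 - r ^ 2)⁻¹) ^ (1 / 2 : ℝ) ≠ ∞ := ENNReal.rpow_ne_top_of_nonneg (by norm_num) hS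
  refine ⟨((1 - r ^ 2)⁻¹) ^ (1 / 2 : ℝ) * C, ENNReal.mul_ne_top hS' hC, fun A => ?_⟩
  set D : ℕ → ℝ≥0∞ := fun l => (2 : ℝ≥0∞) ^ (δ * l) * A l with hD
  rw [mul_assoc]
  refine le_trans (eLpNorm_le_const_mul q hS' (y := fun l => ⨆ d : ℕ, r ^ d * D (l + d))
    fun l => ?_) (by gcongr; exact h D)
  set W := ⨆ d : ℕ, r ^ d * D (l + d) with hW
  have key : ∀ d : ℕ, (2 : ℝ≥0∞) ^ (δ * l) * A (l + d) ≤ r ^ d * W := by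
    intro d
    have h1 : (2 : ℝ≥0∞) ^ (δ * l) * A (l + d) = r ^ d * (r ^ d * D (l + d)) := by
      have : (2 : ℝ≥0∞) ^ (δ * l) = r ^ d * r ^ d * 2 ^ (δ * ((l + d : ℕ) : ℝ)) := by
        rw [hr, ← two_rpow_mul_pow, ← two_rpow_add, ← two_rpow_add]
        congr 1; push_cast; ring
      simp only [hD]; rw [this]; ring
    rw [h1]
    gcongr
    exact le_iSup (fun d : ℕ => r ^ d * D (l + d)) d
  have h2 : ((2 : ℝ≥0∞) ^ (δ * l)) ^ 2 * ∑' d : ℕ, A (l + d) ^ 2 ≤ (1 - r ^ 2)⁻¹ * W ^ 2 := by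
    rw [← ENNReal.tsum_mul_left, ← ENNReal.tsum_geometric, ← ENNReal.tsum_mul_right]
    refine ENNReal.tsum_le_tsum fun d => ?_
    calc _ = ((2 : ℝ≥0∞) ^ (δ * l) * A (l + d)) ^ 2 := by ring
      _ ≤ (r ^ d * W) ^ 2 := pow_le_pow_left' (key d) 2
      _ = _ := by ring
  have hsq : ∀ x : ℝ≥0∞, (x ^ 2) ^ (1 / 2 : ℝ) = x := fun x => by
    rw [← ENNReal.rpow_natCast, ← ENNReal.rpow_mul]; norm_num
  have h3 := ENNReal.rpow_le_rpow h2 (show (0 : ℝ) ≤ 1 / 2 by norm_num)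
  rwa [ENNReal.mul_rpow_of_nonneg _ _ (by norm_num), ENNReal.mul_rpow_of_nonneg _ _ (by norm_num),
    hsq, hsq] at h3

/-! ### Logarithmic blocks of indices: power weights become exponential -/

theorem ennreal_rpow_le_of_comparable {x y κ : ℝ≥0∞} (hx : x ≠ 0) (hx' : x ≠ ∞) (hy : y ≠ 0)
    (hy' : y ≠ ∞) (hxy : x ≤ κ * y) (hyx : y ≤ κ * x) (b : ℝ) :
    x ^ b ≤ κ ^ |b| * y ^ b := by
  rcases le_total 0 b with hb | hb
  · rw [abs_of_nonneg hb, ← ENNReal.mul_rpow_of_nonneg _ _ hb]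
    exact ENNReal.rpow_le_rpow hxy hb
  · rw [abs_of_nonpos hb]
    have h1 : y ^ (-b) ≤ κ ^ (-b) * x ^ (-b) := by
      rw [← ENNReal.mul_rpow_of_nonneg _ _ (by linarith)]
      exact ENNReal.rpow_le_rpow hyx (by linarith)
    calc x ^ b = y ^ (-b) * y ^ b * x ^ b := by
          rw [← ENNReal.rpow_add _ _ hy hy']; simp
      _ ≤ κ ^ (-b) * x ^ (-b) * y ^ b * x ^ b := by gcongr
      _ = κ ^ (-b) * y ^ b * (x ^ (-b) * x ^ b) := by ring
      _ = _ := by rw [← ENNReal.rpow_add _ _ hx hx']; simp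

/-- The `l`-th block of indices `j` with `2 ^ l ≤ j + 1 < 2 ^ (l + 1)`. -/
def logBlock (l : ℕ) : Set ℕ := {j | Nat.log 2 (j + 1) = l}

theorem mem_logBlock {l j : ℕ} : j ∈ logBlock l ↔ 2 ^ l ≤ j + 1 ∧ j + 1 < 2 ^ (l + 1) := by
  rw [logBlock, mem_ofPred_eq, Nat.log_eq_iff]
  simp

theorem count_logBlock (l : ℕ) : Measure.count (logBlock l) = (2 : ℝ≥0∞) ^ l := by
  have : logBlock l = ↑(Finset.Ico (2 ^ l - 1) (2 ^ (l + 1) - 1)) := by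
    ext j
    have := Nat.one_le_two_pow (n := l)
    simp only [mem_logBlock, Finset.coe_Ico, mem_Ico]
    omega
  rw [this, Measure.count_apply_finset, Nat.card_Ico]
  have h1 := Nat.one_le_two_pow (n := l)
  have : 2 ^ (l + 1) - 1 - (2 ^ l - 1) = 2 ^ l := by rw [pow_succ]; omega
  rw [this]; push_cast; rfl

theorem iUnion_logBlock : ⋃ l, logBlock l = univ :=
  eq_univ_of_forall fun _ => mem_iUnion.2 ⟨_, rfl⟩

theorem pairwise_disjoint_logBlock : Pairwise (Function.onFun Disjoint logBlock) := by
  intro l m hlm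
  refine Set.disjoint_left.2 fun j hj hj' => hlm ?_
  rw [← (hj : _ = l), ← (hj' : _ = m)]

theorem eLpNorm_count_eq_logBlock (x : ℕ → ℝ≥0∞) (q : ℝ≥0∞) :
    eLpNorm x q Measure.count =
      eLpNorm (fun l => eLpNorm x q (Measure.count.restrict (logBlock l))) q Measure.count := by
  rw [← eLpNorm_restrict_iUnion_eq (fun _ => .of_discrete) pairwise_disjoint_logBlock,
    iUnion_logBlock, Measure.restrict_univ]

/-- The `ℓ_2` norm over a block. -/
noncomputable def blockNorm (x : ℕ → ℝ≥0∞) (l : ℕ) : ℝ≥0∞ :=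
  eLpNorm x 2 (Measure.count.restrict (logBlock l))

theorem ennreal_sqrt_sq (x : ℝ≥0∞) : (x ^ 2) ^ (1 / 2 : ℝ) = x := by
  rw [← ENNReal.rpow_natCast, ← ENNReal.rpow_mul]; norm_num

theorem ennreal_sq_sqrt (x : ℝ≥0∞) : (x ^ (1 / 2 : ℝ)) ^ 2 = x := by
  rw [← ENNReal.rpow_natCast, ← ENNReal.rpow_mul]; norm_num

theorem blockNorm_sq (x : ℕ → ℝ≥0∞) (l : ℕ) :
    blockNorm x l ^ 2 = ∑' j, (logBlock l).indicator (fun j => x j ^ 2) j := by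
  rw [blockNorm, eLpNorm_eq_lintegral_rpow_enorm_toReal (by norm_num) (by norm_num)]
  simp only [ENNReal.toReal_ofNat]
  rw [ennreal_sq_sqrt, ← lintegral_indicator .of_discrete, lintegral_count]
  refine tsum_congr fun j => ?_
  simp [indicator]

theorem blockNorm_sq_le_tail (x : ℕ → ℝ≥0∞) (l : ℕ) :
    blockNorm x l ^ 2 ≤ ∑' i, x (2 ^ l - 1 + i) ^ 2 := by
  rw [blockNorm_sq]
  have hinj : Function.Injective (fun i => 2 ^ l - 1 + i) := add_right_injective _
  have hsupp : Function.support ((logBlock l).indicator (fun j => x j ^ 2)) ⊆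
      range (fun i => 2 ^ l - 1 + i) := by
    intro j hj
    have := (mem_logBlock.1 (mem_of_indicator_ne_zero hj)).1
    exact ⟨j - (2 ^ l - 1), by simp only; omega⟩
  rw [← hinj.tsum_eq hsupp]
  exact ENNReal.tsum_le_tsum fun i => indicator_le_self' (fun _ _ => zero_le) _

/-- The index `2^l - 1` is the first one of block `l`, so every later index lies in some block `l +
d`. -/
theorem tail_le_tsum_blockNorm (x : ℕ → ℝ≥0∞) (l : ℕ) :
    ∑' i, x (2 ^ l - 1 + i) ^ 2 ≤ ∑' d, blockNorm x (l + d) ^ 2 := by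
  simp_rw [blockNorm_sq]
  rw [ENNReal.tsum_comm]
  refine le_trans ?_ (ENNReal.tsum_comp_le_tsum_of_injective
    (add_right_injective (2 ^ l - 1)) _)
  refine ENNReal.tsum_le_tsum fun i => ?_
  set j := 2 ^ l - 1 + i
  have hl : l ≤ Nat.log 2 (j + 1) := by
    apply Nat.le_log_of_pow_le (by norm_num)
    have := Nat.one_le_two_pow (n := l)
    omega
  obtain ⟨d, hd⟩ := Nat.exists_eq_add_of_le hl
  refine le_trans (le_of_eq ?_) (ENNReal.le_tsum d)
  rw [indicator_of_mem]
  exact hd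

theorem logBlock_weight {l j : ℕ} (hj : j ∈ logBlock l) (b : ℝ) :
    ((j + 1 : ℕ) : ℝ≥0∞) ^ b ≤ 2 ^ |b| * 2 ^ (b * l) ∧
      (2 : ℝ≥0∞) ^ (b * l) ≤ 2 ^ |b| * ((j + 1 : ℕ) : ℝ≥0∞) ^ b := by
  obtain ⟨h1, h2⟩ := mem_logBlock.1 hj
  have e : (2 : ℝ≥0∞) ^ (b * l) = ((2 ^ l : ℕ) : ℝ≥0∞) ^ b := by
    rw [mul_comm, ENNReal.rpow_mul, ENNReal.rpow_natCast]; push_cast; rfl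
  rw [e]
  have ha : ((j + 1 : ℕ) : ℝ≥0∞) ≤ 2 * ((2 ^ l : ℕ) : ℝ≥0∞) := by
    have : j + 1 ≤ 2 * 2 ^ l := by rw [pow_succ] at h2; omega
    exact_mod_cast this
  have hb : ((2 ^ l : ℕ) : ℝ≥0∞) ≤ 2 * ((j + 1 : ℕ) : ℝ≥0∞) := by
    have : 2 ^ l ≤ 2 * (j + 1) := by omega
    exact_mod_cast this
  have hz : ((2 ^ l : ℕ) : ℝ≥0∞) ≠ 0 := by positivity
  have hz' : ((j + 1 : ℕ) : ℝ≥0∞) ≠ 0 := by positivity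
  exact ⟨ennreal_rpow_le_of_comparable hz' (ENNReal.natCast_ne_top _) hz
      (ENNReal.natCast_ne_top _) ha hb b,
    ennreal_rpow_le_of_comparable hz (ENNReal.natCast_ne_top _) hz'
      (ENNReal.natCast_ne_top _) hb ha b⟩

theorem two_rpow_ne_top (b : ℝ) : (2 : ℝ≥0∞) ^ b ≠ ∞ :=
  ENNReal.rpow_ne_top_of_ne_zero (by norm_num) (by norm_num)

theorem eLpNorm_restrict_le_const_mul {X : Type*} [MeasurableSpace X] {μ : Measure X} {S : Set X}
    (hS : MeasurableSet S) {x y : X → ℝ≥0∞} (q : ℝ≥0∞) {c : ℝ≥0∞} (hc : c ≠ ∞)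
    (h : ∀ i ∈ S, x i ≤ c * y i) :
    eLpNorm x q (μ.restrict S) ≤ c * eLpNorm y q (μ.restrict S) := by
  rw [← eLpNorm_const_mul_ennreal y q hc]
  exact eLpNorm_mono_enorm_ae (ae_restrict_of_forall_mem hS fun i hi => by simpa using h i hi)

/-- On block `l` the weight is comparable to `2^{bl}`, and bounding `l_2` by `l_q` over its `2^l`
points costs `2^{l(1/2 - 1/max(2,q))}`. This loss is what is subtracted from `b`. -/
theorem eLpNorm_blockNorm_le {q : ℝ≥0∞} (hq : q ≠ 0) (b : ℝ) :
    ∃ C : ℝ≥0∞, C ≠ ∞ ∧ ∀ x : ℕ → ℝ≥0∞,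
      eLpNorm (fun l : ℕ => (2 : ℝ≥0∞) ^ ((b - recip 2 + recip (max 2 q)) * l) * blockNorm x l) q
        Measure.count ≤
      C * eLpNorm (fun j : ℕ => ((j + 1 : ℕ) : ℝ≥0∞) ^ b * x j) q Measure.count := by
  refine ⟨2 ^ |b|, two_rpow_ne_top _, fun x => ?_⟩
  rw [eLpNorm_count_eq_logBlock (fun j : ℕ => ((j + 1 : ℕ) : ℝ≥0∞) ^ b * x j)]
  refine eLpNorm_le_const_mul q (two_rpow_ne_top _) fun l => ?_
  have h1 := eLpNorm_count_restrict_le_mul (p := 2) hq x (logBlock l)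
  rw [count_logBlock] at h1
  have h2 : (2 : ℝ≥0∞) ^ (b * l) * eLpNorm x q (Measure.count.restrict (logBlock l)) ≤
      2 ^ |b| * eLpNorm (fun j : ℕ => ((j + 1 : ℕ) : ℝ≥0∞) ^ b * x j) q
        (Measure.count.restrict (logBlock l)) := by
    rw [← eLpNorm_const_mul_ennreal _ _ (two_rpow_ne_top _)]
    refine eLpNorm_restrict_le_const_mul .of_discrete q (two_rpow_ne_top _) fun j hj => ?_
    rw [← mul_assoc]
    exact mul_le_mul_left (logBlock_weight hj b).2 _
  refine le_trans ?_ h2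
  calc _ ≤ (2 : ℝ≥0∞) ^ ((b - recip 2 + recip (max 2 q)) * l) *
        (((2 : ℝ≥0∞) ^ l) ^ (recip 2 - recip (max 2 q)) *
          eLpNorm x q (Measure.count.restrict (logBlock l))) := by gcongr; exact h1
    _ = _ := by
      rw [← mul_assoc, ← ENNReal.rpow_natCast, ← ENNReal.rpow_mul, ← two_rpow_add]
      congr 2; ring

theorem eLpNorm_le_blockNorm (q : ℝ≥0∞) (b : ℝ) :
    ∃ C : ℝ≥0∞, C ≠ ∞ ∧ ∀ x : ℕ → ℝ≥0∞,
      eLpNorm (fun j : ℕ => ((j + 1 : ℕ) : ℝ≥0∞) ^ b * x j) q Measure.count ≤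
      C * eLpNorm (fun l : ℕ => (2 : ℝ≥0∞) ^ ((b + recip q - recip (max q 2)) * l) *
        blockNorm x l) q Measure.count := by
  refine ⟨2 ^ |b|, two_rpow_ne_top _, fun x => ?_⟩
  rw [eLpNorm_count_eq_logBlock (fun j : ℕ => ((j + 1 : ℕ) : ℝ≥0∞) ^ b * x j)]
  refine eLpNorm_le_const_mul q (two_rpow_ne_top _) fun l => ?_
  have h1 := eLpNorm_count_restrict_le_mul (p := q) (q := 2) (by norm_num) x (logBlock l)
  rw [count_logBlock] at h1
  have h2 : eLpNorm (fun j : ℕ => ((j + 1 : ℕ) : ℝ≥0∞) ^ b * x j) q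
        (Measure.count.restrict (logBlock l)) ≤
      2 ^ |b| * ((2 : ℝ≥0∞) ^ (b * l) * eLpNorm x q (Measure.count.restrict (logBlock l))) := by
    rw [← eLpNorm_const_mul_ennreal _ _ (two_rpow_ne_top _)]
    refine eLpNorm_restrict_le_const_mul .of_discrete q (two_rpow_ne_top _) fun j hj => ?_
    rw [← mul_assoc]
    exact mul_le_mul_left (logBlock_weight hj b).1 _
  refine h2.trans ?_
  refine mul_le_mul_right ?_ _
  calc _ ≤ (2 : ℝ≥0∞) ^ (b * l) * (((2 : ℝ≥0∞) ^ l) ^ (recip q - recip (max q 2)) *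
          eLpNorm x 2 (Measure.count.restrict (logBlock l))) := by gcongr
    _ = _ := by
      rw [← mul_assoc, ← ENNReal.rpow_natCast, ← ENNReal.rpow_mul, ← two_rpow_add, blockNorm]
      congr 2; ring

/-! Dyadic discretization of the quasi-norms. -/

/-- The dyadic sequence `2^{j/2} c^*_{2^j}`. -/
noncomputable def seqDyadic {ι : Type*} (c : ι → ℂ) (j : ℕ) : ℝ≥0∞ :=
  2 ^ ((1 / 2 : ℝ) * j) * seqRearr c (2 ^ j - 1)

/-- The dyadic sequence `2^{-j/2} f^*(2^{-j})`. -/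
noncomputable def funDyadic (f : ℝ → ℂ) (j : ℕ) : ℝ≥0∞ :=
  2 ^ (-(1 / 2 : ℝ) * j) * funRearr f ((1 / 2) ^ j)

theorem seqRearr_antitone {ι : Type*} (c : ι → ℂ) : Antitone (seqRearr c) := by
  intro k m hkm
  refine sInf_le_sInf fun s hs => ?_
  have hs' : {n | s < ‖c n‖ₑ}.encard ≤ (k : ℕ∞) := hs
  exact hs'.trans (by exact_mod_cast hkm)

theorem funRearr_antitone (f : ℝ → ℂ) : Antitone (funRearr f) := by
  intro s t hst
  refine sInf_le_sInf fun u hu => ?_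
  exact le_trans (hu : _ ≤ ENNReal.ofReal s) (ENNReal.ofReal_le_ofReal hst)

theorem recip_two : recip 2 = 1 / 2 := by simp [recip]

theorem const_mul_measure_rpow_le_eLpNorm {X : Type*} [MeasurableSpace X] {μ : Measure X}
    {S : Set X} (hS : MeasurableSet S) (h0 : μ S ≠ 0) {q : ℝ≥0∞} (hq : q ≠ 0) {v κ : ℝ≥0∞}
    (hκ : κ ≠ ∞) {y : X → ℝ≥0∞} (h : ∀ i ∈ S, v ≤ κ * y i) :
    v * μ S ^ recip q ≤ κ * eLpNorm y q (μ.restrict S) := by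
  have h1 := eLpNorm_restrict_le_const_mul (μ := μ) hS (x := fun _ => v) q hκ h
  rw [eLpNorm_const _ hq (by simpa [Measure.restrict_eq_zero] using h0)] at h1
  simpa [recip] using h1

theorem eLpNorm_le_const_mul_measure_rpow {X : Type*} [MeasurableSpace X] {μ : Measure X}
    {S : Set X} (hS : MeasurableSet S) {q : ℝ≥0∞} {v : ℝ≥0∞} {y : X → ℝ≥0∞}
    (h : ∀ i ∈ S, y i ≤ v) :
    eLpNorm y q (μ.restrict S) ≤ v * μ S ^ recip q := by
  have := eLpNorm_le_of_ae_enorm_bound (p := q) (C := v) (μ := μ.restrict S) (f := y)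
    (ae_restrict_of_forall_mem hS fun i hi => by simpa using h i hi)
  simpa [recip] using this

theorem ofReal_comparable_rpow {u v : ℝ} (hu : 0 < u) (hv : 0 < v) (h1 : u ≤ 2 * v)
    (h2 : v ≤ 2 * u) (b : ℝ) :
    ENNReal.ofReal u ^ b ≤ 2 ^ |b| * ENNReal.ofReal v ^ b := by
  have e : (2 : ℝ≥0∞) = ENNReal.ofReal 2 := by simp
  refine ennreal_rpow_le_of_comparable (by simpa using hu) ENNReal.ofReal_ne_top
    (by simpa using hv) ENNReal.ofReal_ne_top ?_ ?_ b
  · rw [e, ← ENNReal.ofReal_mul (by norm_num)]; exact ENNReal.ofReal_le_ofReal h1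
  · rw [e, ← ENNReal.ofReal_mul (by norm_num)]; exact ENNReal.ofReal_le_ofReal h2

/-- The shells are cut by the upper logarithm, `2^(j-1) < k+1 ≤ 2^j`, so that by monotonicity
`c^*_{2^j}` bounds the rearrangement from below on the whole shell. The shell's size, at least `2^j
/ 2`, supplies the power `1/q` that turns the exponent `1/2 - 1/q` into `1/2`. -/
theorem eLpNorm_seqDyadic_le {q : ℝ≥0∞} (hq : q ≠ 0) (b : ℝ) :
    ∃ C : ℝ≥0∞, C ≠ ∞ ∧ ∀ {ι : Type} (c : ι → ℂ),
      eLpNorm (fun j : ℕ => ((j + 1 : ℕ) : ℝ≥0∞) ^ b * seqDyadic c j) q Measure.count ≤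
        C * seqLZNorm 2 q b c := by
  set e := recip 2 - recip q with he
  set S : ℕ → Set ℕ := fun j => {k | Nat.clog 2 (k + 1) = j} with hS
  set κ : ℝ≥0∞ := 2 ^ |e| * 2 ^ |b| with hκ
  have hκt : κ ≠ ∞ := ENNReal.mul_ne_top (two_rpow_ne_top _) (two_rpow_ne_top _)
  refine ⟨2 ^ recip q * κ, ENNReal.mul_ne_top (two_rpow_ne_top _) hκt, fun {ι} c => ?_⟩
  have hU : ⋃ j, S j = univ := eq_univ_of_forall fun _ => mem_iUnion.2 ⟨_, rfl⟩
  have hD : Pairwise (Function.onFun Disjoint S) := by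
    intro l m hlm
    refine Set.disjoint_left.2 fun j hj hj' => hlm ?_
    rw [← (hj : _ = l), ← (hj' : _ = m)]
  have hpart := fun y => eLpNorm_restrict_iUnion_eq (μ := Measure.count) (fun _ => .of_discrete)
    hD y q
  rw [hU, Measure.restrict_univ] at hpart
  conv_rhs => rw [seqLZNorm, hpart]
  refine eLpNorm_le_const_mul q (ENNReal.mul_ne_top (two_rpow_ne_top _) hκt) fun j => ?_
  have hmem : ∀ k ∈ S j, k + 1 ≤ 2 ^ j ∧ 2 ^ j ≤ 2 * (k + 1) := by
    intro k hk
    have hk' : Nat.clog 2 (k + 1) = j := hk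
    refine ⟨hk' ▸ Nat.le_pow_clog (by norm_num) _, ?_⟩
    rcases Nat.eq_zero_or_pos j with rfl | hj
    · rw [pow_zero]; omega
    · rcases Nat.eq_zero_or_pos k with rfl | hk0
      · simp at hk'; omega
      have := Nat.pow_pred_clog_lt_self (b := 2) (by norm_num) (x := k + 1) (by omega)
      rw [hk', ← Nat.sub_one] at this
      obtain ⟨i, rfl⟩ : ∃ i, j = i + 1 := ⟨j - 1, by omega⟩
      rw [pow_succ]
      simp at this
      omega
  have hcount : (2 : ℝ≥0∞) ^ j ≤ 2 * Measure.count (S j) := by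
    rcases Nat.eq_zero_or_pos j with rfl | hj
    · have : ({0} : Set ℕ) ⊆ S 0 := by rintro _ rfl; simp [hS]
      have := measure_mono (μ := Measure.count) this
      rw [Measure.count_singleton] at this
      calc (2 : ℝ≥0∞) ^ 0 = 1 := by simp
        _ ≤ 2 * 1 := by norm_num
        _ ≤ _ := by gcongr
    · obtain ⟨i, rfl⟩ : ∃ i, j = i + 1 := ⟨j - 1, by omega⟩
      have hsub : (↑(Finset.Ico (2 ^ i) (2 ^ (i + 1))) : Set ℕ) ⊆ S (i + 1) := by
        intro k hk
        simp only [Finset.coe_Ico, mem_Ico] at hk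
        simp only [hS, mem_ofPred_eq]
        apply le_antisymm
        · exact Nat.clog_le_of_le_pow (by omega)
        · exact (Nat.lt_clog_iff_pow_lt (by norm_num)).2 (by omega)
      have := measure_mono (μ := Measure.count) hsub
      rw [Measure.count_apply_finset, Nat.card_Ico] at this
      have h2 : 2 ^ (i + 1) - 2 ^ i = 2 ^ i := by rw [pow_succ]; omega
      rw [h2] at this
      push_cast at this
      calc (2 : ℝ≥0∞) ^ (i + 1) = 2 * 2 ^ i := by ring
        _ ≤ _ := by gcongr
  have hne : Measure.count (S j) ≠ 0 := by
    intro h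
    rw [h, mul_zero] at hcount
    exact absurd hcount (by simp)
  have hr : 0 ≤ recip q := ENNReal.toReal_nonneg
  set v : ℝ≥0∞ := 2 ^ (e * j) * ((j + 1 : ℕ) : ℝ≥0∞) ^ b * seqRearr c (2 ^ j - 1) with hv
  have h1 : v * Measure.count (S j) ^ recip q ≤ κ * eLpNorm (fun k : ℕ =>
      ENNReal.ofReal (((k : ℝ) + 1) ^ (recip 2 - recip q) * (1 + Real.log ((k : ℝ) + 1)) ^ b)
        * seqRearr c k) q (Measure.count.restrict (S j)) := by
    refine const_mul_measure_rpow_le_eLpNorm .of_discrete hne hq hκt fun k hk => ?_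
    obtain ⟨ha, hb⟩ := hmem k hk
    have ha' : (k : ℝ) + 1 ≤ 2 ^ j := by exact_mod_cast ha
    have hb' : (2 : ℝ) ^ j ≤ 2 * ((k : ℝ) + 1) := by exact_mod_cast hb
    have hk0 : (0 : ℝ) < (k : ℝ) + 1 := by positivity
    have hlog : 0 ≤ Real.log ((k : ℝ) + 1) := Real.log_nonneg (by linarith [k.cast_nonneg (α := ℝ)])
    have l1 : Real.log ((k : ℝ) + 1) ≤ j * Real.log 2 := by
      rw [← Real.log_pow]; exact Real.log_le_log hk0 ha'
    have l2 : j * Real.log 2 ≤ Real.log 2 + Real.log ((k : ℝ) + 1) := by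
      rw [← Real.log_pow, ← Real.log_mul (by norm_num) hk0.ne']
      exact Real.log_le_log (by positivity) hb'
    -- Since `1/2 < log 2 < 1`, the weights `1 + log (k+1)` and `j + 1` agree within a factor 2.
    have g1 := Real.log_two_gt_d9
    have g2 := Real.log_two_lt_d9
    have hj0 : (0 : ℝ) ≤ j := by positivity
    rw [ENNReal.ofReal_mul (by positivity), ← ENNReal.ofReal_rpow_of_pos hk0,
      ← ENNReal.ofReal_rpow_of_pos (by linarith)]
    have w1 := ofReal_comparable_rpow (u := 2 ^ j) (v := (k : ℝ) + 1) (by positivity) hk0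
      hb' (by linarith) e
    have w2 := ofReal_comparable_rpow (u := j + 1) (v := 1 + Real.log ((k : ℝ) + 1))
      (by positivity) (by linarith) (by nlinarith) (by nlinarith) b
    have e1 : ENNReal.ofReal (2 ^ j) ^ e = 2 ^ (e * j) := by
      rw [ENNReal.ofReal_pow (by norm_num), mul_comm, ENNReal.rpow_mul, ENNReal.rpow_natCast]
      simp
    have e2 : ENNReal.ofReal ((j : ℝ) + 1) = ((j + 1 : ℕ) : ℝ≥0∞) := by
      rw [← ENNReal.ofReal_natCast]; push_cast; rfl
    rw [e1] at w1
    rw [e2] at w2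
    have w3 : seqRearr c (2 ^ j - 1) ≤ seqRearr c k := seqRearr_antitone c (by omega)
    calc v ≤ (2 ^ |e| * ENNReal.ofReal ((k : ℝ) + 1) ^ e) *
          (2 ^ |b| * ENNReal.ofReal (1 + Real.log ((k : ℝ) + 1)) ^ b) * seqRearr c k := by
          rw [hv]; exact mul_le_mul' (mul_le_mul' w1 w2) w3
      _ = _ := by rw [hκ, he]; ring
  rw [mul_assoc]
  refine le_trans ?_ (mul_le_mul_right h1 _)
  have h2 : (2 : ℝ≥0∞) ^ (recip q * j) ≤ 2 ^ recip q * Measure.count (S j) ^ recip q := by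
    rw [← ENNReal.mul_rpow_of_nonneg _ _ hr, mul_comm, ENNReal.rpow_mul, ENNReal.rpow_natCast]
    exact ENNReal.rpow_le_rpow hcount hr
  calc ((j + 1 : ℕ) : ℝ≥0∞) ^ b * seqDyadic c j
      = v * 2 ^ (recip q * j) := by
        have : (2 : ℝ≥0∞) ^ ((1 / 2 : ℝ) * j) = 2 ^ (e * j) * 2 ^ (recip q * j) := by
          rw [← two_rpow_add, he, recip_two]; congr 1; ring
        rw [hv, seqDyadic, this]; ring
    _ ≤ v * (2 ^ recip q * Measure.count (S j) ^ recip q) := by gcongr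
    _ = _ := by ring

/-- On the shell `2^{-j} < t ≤ 2·2^{-j}` the rearrangement is at most its value at `2^{-j}`. The
shell `j = 0` is empty inside `(0,1)` and is kept only for uniform indexing. -/
theorem funLZNorm_le_eLpNorm_funDyadic (q : ℝ≥0∞) (b : ℝ) :
    ∃ C : ℝ≥0∞, C ≠ ∞ ∧ ∀ f : ℝ → ℂ, funLZNorm 2 q b f ≤
      C * eLpNorm (fun j : ℕ => ((j + 1 : ℕ) : ℝ≥0∞) ^ b * funDyadic f j) q Measure.count := by
  set e := recip 2 - recip q with he
  set S : ℕ → Set ℝ := fun j => Ioc ((1 / 2) ^ j) (2 * (1 / 2) ^ j) ∩ Ioo 0 1 with hS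
  set κ : ℝ≥0∞ := 2 ^ |e| * 2 ^ |b| with hκ
  have hκt : κ ≠ ∞ := ENNReal.mul_ne_top (two_rpow_ne_top _) (two_rpow_ne_top _)
  refine ⟨κ, hκt, fun f => ?_⟩
  have hU : ⋃ j, S j = Ioo 0 1 := by
    ext t
    simp only [hS, mem_iUnion, mem_inter_iff]
    refine ⟨fun ⟨j, _, h⟩ => h, fun h => ?_⟩
    obtain ⟨n, h1, h2⟩ := exists_nat_pow_near_of_lt_one h.1 h.2.le (y := (1 / 2 : ℝ))
      (by norm_num) (by norm_num)
    exact ⟨n + 1, ⟨h1, by rw [pow_succ]; linarith⟩, h⟩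
  have hlt : ∀ i j : ℕ, i < j → Disjoint (S i) (S j) := by
    intro i j hij
    refine Set.disjoint_left.2 fun t ht ht' => ?_
    have h1 : (1 / 2 : ℝ) ^ i < t := ht.1.1
    have h2 : t ≤ 2 * (1 / 2 : ℝ) ^ j := ht'.1.2
    have h3 : (1 / 2 : ℝ) ^ j ≤ (1 / 2) ^ (i + 1) :=
      pow_le_pow_of_le_one (by norm_num) (by norm_num) hij
    rw [pow_succ] at h3
    linarith
  have hD : Pairwise (Function.onFun Disjoint S) := by
    intro i j hij
    rcases lt_or_gt_of_ne hij with h | h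
    · exact hlt i j h
    · exact (hlt j i h).symm
  have hm : ∀ j, MeasurableSet (S j) := fun j => measurableSet_Ioc.inter measurableSet_Ioo
  rw [funLZNorm, ← hU, eLpNorm_restrict_iUnion_eq hm hD]
  refine eLpNorm_le_const_mul q hκt fun j => ?_
  set p : ℝ := (1 / 2) ^ j with hp
  have hp0 : 0 < p := by positivity
  set v : ℝ≥0∞ := κ * (ENNReal.ofReal p ^ e * ((j + 1 : ℕ) : ℝ≥0∞) ^ b * funRearr f p) with hv
  have hr : 0 ≤ recip q := ENNReal.toReal_nonneg
  have h1 := eLpNorm_le_const_mul_measure_rpow (μ := volume) (hm j) (q := q) (v := v) (y :=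
    fun t : ℝ => ENNReal.ofReal (t ^ (recip 2 - recip q) * (1 + |Real.log t|) ^ b) * funRearr f t)
    (fun t ht => by
      obtain ⟨⟨ha, hb⟩, h0, h1⟩ := ht
      have ha' : p < t := ha
      have hb' : t ≤ 2 * p := hb
      have hlog : |Real.log t| = - Real.log t := abs_of_nonpos (Real.log_nonpos h0.le h1.le)
      have hlog0 := abs_nonneg (Real.log t)
      have lp : Real.log p = - (j * Real.log 2) := by
        rw [hp, one_div, inv_pow, Real.log_inv, Real.log_pow]
      have l1 : - (j * Real.log 2) ≤ Real.log t := by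
        rw [← lp]; exact Real.log_le_log hp0 ha'.le
      have l2 : Real.log t ≤ Real.log 2 - j * Real.log 2 := by
        rw [sub_eq_add_neg, ← lp, ← Real.log_mul (by norm_num) hp0.ne']
        exact Real.log_le_log h0 hb'
      have g1 := Real.log_two_gt_d9
      have g2 := Real.log_two_lt_d9
      have hj0 : (0 : ℝ) ≤ j := by positivity
      rw [ENNReal.ofReal_mul (by positivity), ← ENNReal.ofReal_rpow_of_pos h0,
        ← ENNReal.ofReal_rpow_of_pos (by linarith)]
      have w1 := ofReal_comparable_rpow (u := t) (v := p) h0 hp0 hb' (by linarith) e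
      have w2 := ofReal_comparable_rpow (u := 1 + |Real.log t|) (v := j + 1)
        (by linarith) (by positivity) (by nlinarith) (by nlinarith) b
      have e2 : ENNReal.ofReal ((j : ℝ) + 1) = ((j + 1 : ℕ) : ℝ≥0∞) := by
        rw [← ENNReal.ofReal_natCast]; push_cast; rfl
      rw [e2] at w2
      calc _ ≤ (2 ^ |e| * ENNReal.ofReal p ^ e) * (2 ^ |b| * ((j + 1 : ℕ) : ℝ≥0∞) ^ b) *
            funRearr f p := mul_le_mul' (mul_le_mul' w1 w2) (funRearr_antitone f ha'.le)
        _ = v := by rw [hv, hκ]; ring)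
  refine h1.trans ?_
  have h2 : volume (S j) ≤ ENNReal.ofReal p := by
    refine (measure_mono inter_subset_left).trans ?_
    rw [Real.volume_Ioc]
    exact ENNReal.ofReal_le_ofReal (by linarith)
  have hpp : ENNReal.ofReal p = 2 ^ (-(j : ℝ)) := by
    rw [hp, ENNReal.ofReal_pow (by norm_num), ENNReal.rpow_neg, ENNReal.rpow_natCast, one_div,
      ENNReal.ofReal_inv_of_pos (by norm_num), ENNReal.inv_pow]
    simp
  calc v * volume (S j) ^ recip q ≤ v * ENNReal.ofReal p ^ recip q := by gcongr
    _ = κ * (((j + 1 : ℕ) : ℝ≥0∞) ^ b * ((ENNReal.ofReal p ^ e * ENNReal.ofReal p ^ recip q) *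
        funRearr f p)) := by rw [hv]; ring
    _ = _ := by
      rw [funDyadic, hpp, ← ENNReal.rpow_mul, ← ENNReal.rpow_mul, ← two_rpow_add]
      congr 4
      rw [he, recip_two]; ring

/-! Splitting a sequence at a dyadic level of its rearrangement. -/

/-- The infimum is attained: among `k + 1` terms above it, the smallest would still exceed some
admissible `s`, giving `k + 1` terms above `s`. -/
theorem encard_seqRearr_lt_le {ι : Type*} (c : ι → ℂ) (k : ℕ) :
    {n | seqRearr c k < ‖c n‖ₑ}.encard ≤ k := by
  by_contra! h
  obtain ⟨t, ht, hcard⟩ := Set.exists_subset_encard_eq (k := (k : ℕ∞) + 1)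
    (Order.add_one_le_of_lt h)
  have hfin : t.Finite := Set.finite_of_encard_eq_coe (k := k + 1) (by rw [hcard]; push_cast; rfl)
  have hne : t.Nonempty := by
    rw [← Set.encard_pos, hcard]; positivity
  obtain ⟨m, hm, hmin⟩ := Set.exists_min_image t (fun n => ‖c n‖ₑ) hfin hne
  obtain ⟨s, hs, hsm⟩ := sInf_lt_iff.1 (show sInf _ < ‖c m‖ₑ from ht hm)
  have hs' : {n | s < ‖c n‖ₑ}.encard ≤ (k : ℕ∞) := hs
  have hsub : t ⊆ {n | s < ‖c n‖ₑ} := fun n hn => hsm.trans_le (hmin n hn)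
  have := (Set.encard_le_encard hsub).trans hs'
  rw [hcard] at this
  exact absurd this (not_le.2 (by exact_mod_cast Nat.lt_succ_self k))

/-- The indices of the terms exceeding the rearrangement at `2 ^ j`. -/
def upperLevel {ι : Type*} (c : ι → ℂ) (j : ℕ) : Set ι := {n | seqRearr c (2 ^ j - 1) < ‖c n‖ₑ}

theorem tsum_indicator_upperLevel_le {ι : Type*} (c : ι → ℂ) (j : ℕ) (v : ℝ≥0∞) :
    ∑' n, (upperLevel c j).indicator (fun _ => v) n ≤ 2 ^ j * v := by
  rw [← tsum_subtype, ENNReal.tsum_set_const]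
  gcongr
  have h1 : (upperLevel c j).encard ≤ ((2 ^ j : ℕ) : ℕ∞) :=
    (encard_seqRearr_lt_le c _).trans (by exact_mod_cast Nat.sub_le _ _)
  calc ((upperLevel c j).encard : ℝ≥0∞) ≤ (((2 ^ j : ℕ) : ℕ∞) : ℝ≥0∞) := by exact_mod_cast h1
    _ = 2 ^ j := by push_cast; rfl

theorem finite_upperLevel {ι : Type*} (c : ι → ℂ) (j : ℕ) : (upperLevel c j).Finite :=
  Set.finite_of_encard_le_coe (encard_seqRearr_lt_le c _)

theorem upperLevel_zero {ι : Type*} (c : ι → ℂ) : upperLevel c 0 = ∅ := by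
  rw [← Set.encard_eq_zero, ← nonpos_iff_eq_zero]
  exact encard_seqRearr_lt_le c 0

theorem upperLevel_mono {ι : Type*} (c : ι → ℂ) : Monotone (upperLevel c) := by
  intro i j hij n hn
  refine lt_of_le_of_lt (seqRearr_antitone c ?_) hn
  exact Nat.sub_le_sub_right (Nat.pow_le_pow_right (by norm_num) hij) 1

theorem exists_mem_upperLevel_succ {ι : Type*} (c : ι → ℂ) {n : ι}
    (h : ∃ i, n ∈ upperLevel c i) :
    ∃ i, n ∈ upperLevel c (i + 1) ∧ n ∉ upperLevel c i := by
  classical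
  have h0 : Nat.find h ≠ 0 := by
    intro h0
    have := Nat.find_spec h
    rw [h0, upperLevel_zero] at this
    exact this
  obtain ⟨i, hi⟩ := Nat.exists_eq_succ_of_ne_zero h0
  refine ⟨i, ?_, Nat.find_min h (by omega)⟩
  have := Nat.find_spec h
  rwa [hi] at this

theorem seqDyadic_sq {ι : Type*} (c : ι → ℂ) (j : ℕ) :
    seqDyadic c j ^ 2 = 2 ^ j * seqRearr c (2 ^ j - 1) ^ 2 := by
  rw [seqDyadic, mul_pow, mul_comm (1 / 2 : ℝ), ENNReal.rpow_mul, ennreal_sq_sqrt,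
    ENNReal.rpow_natCast]

/-- Decompose into layers `upperLevel c (i+1) \ upperLevel c i`: each has at most `2^(i+1)` indices
(whence the factor 2), and its terms are at most `c^*_{2^i}`. Finiteness of the sum forces
`c^*_{2^i} → 0`, so every nonzero coefficient lies in a layer. -/
theorem tsum_lowerLevel_sq_le {ι : Type*} (c : ι → ℂ)
    (hT : ∑' i, seqDyadic c i ^ 2 ≠ ∞) (J : ℕ) :
    ∑' n, (upperLevel c J)ᶜ.indicator (fun n => ‖c n‖ₑ ^ 2) n ≤
      2 * ∑' i, seqDyadic c (J + i) ^ 2 := by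
  have hlim : Filter.Tendsto (fun i => seqDyadic c i ^ 2) Filter.atTop (nhds 0) :=
    ENNReal.tendsto_atTop_zero_of_tsum_ne_top hT
  have hex : ∀ n, c n ≠ 0 → ∃ i, n ∈ upperLevel c i := by
    intro n hn
    have hpos : 0 < ‖c n‖ₑ ^ 2 := by
      have : 0 < ‖c n‖ₑ := by simpa using hn
      positivity
    obtain ⟨i, hi⟩ := ((tendsto_order.1 hlim).2 _ hpos).exists
    refine ⟨i, ?_⟩
    have h1 : seqRearr c (2 ^ i - 1) ^ 2 < ‖c n‖ₑ ^ 2 := by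
      refine lt_of_le_of_lt ?_ hi
      rw [seqDyadic_sq]
      exact le_mul_of_one_le_left' (one_le_pow₀ (by norm_num))
    exact lt_of_not_ge fun h => not_le.2 h1 (pow_le_pow_left' h 2)
  calc ∑' n, (upperLevel c J)ᶜ.indicator (fun n => ‖c n‖ₑ ^ 2) n
      ≤ ∑' n, ∑' i, (upperLevel c (J + i + 1)).indicator
          (fun _ => seqRearr c (2 ^ (J + i) - 1) ^ 2) n := by
        refine ENNReal.tsum_le_tsum fun n => ?_
        by_cases hn : n ∈ (upperLevel c J)ᶜ
        · rw [indicator_of_mem hn]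
          by_cases h0 : c n = 0
          · simp [h0]
          obtain ⟨i, hi1, hi2⟩ := exists_mem_upperLevel_succ c (hex n h0)
          have hJi : J ≤ i := by
            by_contra! hlt
            exact hn (upperLevel_mono c hlt hi1)
          obtain ⟨d, rfl⟩ := Nat.exists_eq_add_of_le hJi
          refine le_trans ?_ (ENNReal.le_tsum d)
          rw [indicator_of_mem hi1]
          exact pow_le_pow_left' (not_lt.1 hi2) 2
        · rw [indicator_of_notMem hn]; exact zero_le
    _ = ∑' i, ∑' n, (upperLevel c (J + i + 1)).indicator
          (fun _ => seqRearr c (2 ^ (J + i) - 1) ^ 2) n := ENNReal.tsum_comm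
    _ ≤ ∑' i, 2 * seqDyadic c (J + i) ^ 2 := by
        refine ENNReal.tsum_le_tsum fun i => ?_
        refine (tsum_indicator_upperLevel_le c _ _).trans (le_of_eq ?_)
        rw [seqDyadic_sq]; ring
    _ = _ := ENNReal.tsum_mul_left

/-- The same layers, now those below `J`, with first powers. Since `upperLevel c 0` is empty they
exhaust `upperLevel c J`. -/
theorem tsum_upperLevel_le {ι : Type*} (c : ι → ℂ) (J : ℕ) :
    ∑' n, (upperLevel c J).indicator (fun n => ‖c n‖ₑ) n ≤
      2 * ∑ i ∈ Finset.range J, 2 ^ ((1 / 2 : ℝ) * i) * seqDyadic c i := by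
  calc ∑' n, (upperLevel c J).indicator (fun n => ‖c n‖ₑ) n
      ≤ ∑' n, ∑ i ∈ Finset.range J, (upperLevel c (i + 1)).indicator
          (fun _ => seqRearr c (2 ^ i - 1)) n := by
        refine ENNReal.tsum_le_tsum fun n => ?_
        by_cases hn : n ∈ upperLevel c J
        · rw [indicator_of_mem hn]
          obtain ⟨i, hi1, hi2⟩ := exists_mem_upperLevel_succ c ⟨J, hn⟩
          have hJi : i < J := by
            by_contra! hle
            exact hi2 (upperLevel_mono c hle hn)
          refine le_trans ?_ (Finset.single_le_sum (fun _ _ => zero_le)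
            (Finset.mem_range.2 hJi))
          rw [indicator_of_mem hi1]
          exact not_lt.1 hi2
        · rw [indicator_of_notMem hn]; exact zero_le
    _ = ∑ i ∈ Finset.range J, ∑' n, (upperLevel c (i + 1)).indicator
          (fun _ => seqRearr c (2 ^ i - 1)) n :=
        Summable.tsum_finsetSum fun _ _ => ENNReal.summable
    _ ≤ _ := by
        rw [Finset.mul_sum]
        refine Finset.sum_le_sum fun i _ => ?_
        refine (tsum_indicator_upperLevel_le c _ _).trans (le_of_eq ?_)
        have : (2 : ℝ≥0∞) ^ ((1 / 2 : ℝ) * i) * 2 ^ ((1 / 2 : ℝ) * i) = 2 ^ i := by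
          rw [← two_rpow_add, ← ENNReal.rpow_natCast]; congr 1; ring
        rw [seqDyadic, ← mul_assoc (2 ^ ((1 / 2 : ℝ) * i)), this]; ring

theorem sum_two_rpow_half_le (J : ℕ) :
    ∑ i ∈ Finset.range J, (2 : ℝ≥0∞) ^ ((1 / 2 : ℝ) * i) ≤ 4 * 2 ^ ((1 / 2 : ℝ) * J) := by
  induction J with
  | zero => simp
  | succ J ih =>
    rw [Finset.sum_range_succ]
    -- The induction closes because `4 + 1 ≤ 4√2`, i.e. `25 ≤ 32`.
    have h2 : (5 : ℝ≥0∞) ≤ 4 * 2 ^ (1 / 2 : ℝ) := by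
      have : (5 : ℝ≥0∞) ^ 2 ≤ (4 * 2 ^ (1 / 2 : ℝ)) ^ 2 := by
        rw [mul_pow, ennreal_sq_sqrt]; norm_num
      exact le_of_not_gt fun h => not_le.2 (ENNReal.pow_lt_pow_left (by norm_num) h) this
    calc _ ≤ 4 * 2 ^ ((1 / 2 : ℝ) * J) + 2 ^ ((1 / 2 : ℝ) * J) := by gcongr
      _ = 5 * (2 : ℝ≥0∞) ^ ((1 / 2 : ℝ) * J) := by ring
      _ ≤ 4 * 2 ^ (1 / 2 : ℝ) * 2 ^ ((1 / 2 : ℝ) * J) := by gcongr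
      _ = _ := by
        rw [mul_assoc, ← two_rpow_add]; congr 2; push_cast; ring

/-! Rearrangements of functions. -/

theorem funRearr_le_add {f g : ℝ → ℂ} {Q : ℝ≥0∞} (h : ∀ᵐ x ∂volI, ‖f x‖ₑ ≤ ‖g x‖ₑ + Q) (t : ℝ) :
    funRearr f t ≤ funRearr g t + Q := by
  rw [funRearr, funRearr, ENNReal.sInf_add]
  refine le_iInf₂ fun s hs => sInf_le ?_
  refine le_trans (measure_mono_ae ?_) hs
  filter_upwards [h] with x hx hsx
  have hsx' : s + Q < ‖f x‖ₑ := hsx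
  exact lt_of_add_lt_add_right (hsx'.trans_le hx)

/-- A dyadic geometric series is twice its first term, and the first admissible term is below `D`.
-/
theorem tsum_dyadic_lt_le (D : ℝ≥0∞) :
    ∑' i : ℕ, {i : ℕ | (2⁻¹ : ℝ≥0∞) ^ i < D}.indicator (fun i => (2⁻¹ : ℝ≥0∞) ^ i) i ≤ 2 * D := by
  classical
  by_cases h : ∃ i : ℕ, (2⁻¹ : ℝ≥0∞) ^ i < D
  · set i0 := Nat.find h
    have hinj : Function.Injective (fun i => i0 + i) := add_right_injective _
    rw [← hinj.tsum_eq]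
    · calc _ ≤ ∑' i : ℕ, (2⁻¹ : ℝ≥0∞) ^ i0 * 2⁻¹ ^ i := by
            refine ENNReal.tsum_le_tsum fun i => ?_
            rw [← pow_add]
            exact indicator_le_self' (fun _ _ => zero_le) _
        _ = (2⁻¹ : ℝ≥0∞) ^ i0 * 2 := by
            rw [ENNReal.tsum_mul_left, ENNReal.tsum_geometric, ENNReal.one_sub_inv_two, inv_inv]
        _ ≤ D * 2 := by gcongr; exact (Nat.find_spec h).le
        _ = 2 * D := mul_comm _ _
    · intro i hi
      have hi' : i ∈ {i : ℕ | (2⁻¹ : ℝ≥0∞) ^ i < D} := mem_of_indicator_ne_zero hi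
      exact ⟨i - i0, by have := Nat.find_min' h hi'; simp only; omega⟩
  · refine le_of_eq_of_le ?_ zero_le
    rw [ENNReal.tsum_eq_zero]
    intro i
    exact indicator_of_notMem (s := {i : ℕ | (2⁻¹ : ℝ≥0∞) ^ i < D}) (fun hi => h ⟨i, hi⟩) _

theorem lintegral_indicator_ofReal_lt (y : ℝ≥0∞) :
    ∫⁻ t in Ioi (0 : ℝ), {t : ℝ | ENNReal.ofReal t < y}.indicator 1 t = y := by
  have hm : MeasurableSet {t : ℝ | ENNReal.ofReal t < y} :=
    measurableSet_lt ENNReal.measurable_ofReal measurable_const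
  rw [lintegral_indicator_one hm, Measure.restrict_apply hm]
  rcases eq_or_ne y ∞ with rfl | hy
  · simp
  · have : {t : ℝ | ENNReal.ofReal t < y} ∩ Ioi 0 = Ioo 0 y.toReal := by
      ext t
      simp only [mem_inter_iff, mem_ofPred_eq, mem_Ioi, mem_Ioo]
      constructor
      · rintro ⟨h1, h2⟩
        exact ⟨h2, (ENNReal.ofReal_lt_iff_lt_toReal h2.le hy).1 h1⟩
      · rintro ⟨h1, h2⟩
        exact ⟨(ENNReal.ofReal_lt_iff_lt_toReal h1.le hy).2 h2, h1⟩
    rw [this, Real.volume_Ioo]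
    simp [hy]

theorem funDyadic_sq (f : ℝ → ℂ) (j : ℕ) :
    funDyadic f j ^ 2 = 2⁻¹ ^ j * funRearr f ((1 / 2) ^ j) ^ 2 := by
  have : -(1 / 2 : ℝ) * j = -(j : ℝ) * (1 / 2) := by ring
  rw [funDyadic, mul_pow, this, ENNReal.rpow_mul, ennreal_sq_sqrt, ENNReal.rpow_neg,
    ENNReal.rpow_natCast, ENNReal.inv_pow]

theorem ofReal_half_pow (i : ℕ) : ENNReal.ofReal ((1 / 2) ^ i) = 2⁻¹ ^ i := by
  rw [ENNReal.ofReal_pow (by norm_num), one_div, ENNReal.ofReal_inv_of_pos (by norm_num)]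
  simp

/-- Layer-cake argument: write `g^*(2^{-i})^2` as an integral over levels `t` and exchange sum and
integral. At level `t` only those `i` contribute for which `2^{-i}` is less than the measure of
`{|g|^2 > t}`, and these `2^{-i}` sum to at most twice that measure. -/
theorem tsum_funDyadic_sq_le {g : ℝ → ℂ} (hg : AEStronglyMeasurable g volI) :
    ∑' i, funDyadic g i ^ 2 ≤ 2 * ∫⁻ x, ‖g x‖ₑ ^ 2 ∂volI := by
  have hlc := lintegral_eq_lintegral_meas_lt (f := fun x => ‖g x‖ ^ 2) volI
    (Filter.Eventually.of_forall fun x => by positivity) (hg.norm.aemeasurable.pow_const 2)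
  have hE : ∀ x, ENNReal.ofReal (‖g x‖ ^ 2) = ‖g x‖ₑ ^ 2 := fun x => by
    rw [ENNReal.ofReal_pow (norm_nonneg _), ofReal_norm]
  simp_rw [hE] at hlc
  rw [hlc]
  set y : ℕ → ℝ≥0∞ := fun i => funRearr g ((1 / 2) ^ i) ^ 2 with hy
  have hm : ∀ i, MeasurableSet {t : ℝ | ENNReal.ofReal t < y i} := fun i =>
    measurableSet_lt ENNReal.measurable_ofReal measurable_const
  calc ∑' i, funDyadic g i ^ 2
      = ∑' i, ∫⁻ t in Ioi (0 : ℝ),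
          2⁻¹ ^ i * {t : ℝ | ENNReal.ofReal t < y i}.indicator 1 t := by
        refine tsum_congr fun i => ?_
        rw [lintegral_const_mul _ (measurable_one.indicator (hm i)),
          lintegral_indicator_ofReal_lt, funDyadic_sq]
    _ = ∫⁻ t in Ioi (0 : ℝ), ∑' i,
          2⁻¹ ^ i * {t : ℝ | ENNReal.ofReal t < y i}.indicator 1 t :=
        (lintegral_tsum fun i =>
          ((measurable_one.indicator (hm i)).const_mul _).aemeasurable).symm
    _ ≤ ∫⁻ t in Ioi (0 : ℝ), 2 * volI {a | t < ‖g a‖ ^ 2} := by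
        refine setLIntegral_mono' measurableSet_Ioi fun t ht => ?_
        refine le_trans (ENNReal.tsum_le_tsum fun i => ?_) (tsum_dyadic_lt_le _)
        by_cases hi : ENNReal.ofReal t < y i
        · rw [indicator_of_mem (show t ∈ {t : ℝ | ENNReal.ofReal t < y i} from hi),
            indicator_of_mem]
          · simp
          · rw [mem_ofPred_eq, ← ofReal_half_pow]
            have h1 : ENNReal.ofReal t ^ (1 / 2 : ℝ) < funRearr g ((1 / 2) ^ i) := by
              rw [← ennreal_sqrt_sq (funRearr g ((1 / 2) ^ i))]
              exact ENNReal.rpow_lt_rpow hi (by norm_num)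
            have h2 := notMem_of_lt_csInf h1 (OrderBot.bddBelow _)
            rw [mem_ofPred_eq, not_le] at h2
            refine h2.trans_le (measure_mono fun a ha => ?_)
            have ha' : ENNReal.ofReal t ^ (1 / 2 : ℝ) < ‖g a‖ₑ := ha
            have h3 := ENNReal.pow_lt_pow_left (n := 2) (by norm_num) ha'
            rw [ennreal_sq_sqrt, ← hE] at h3
            exact (ENNReal.ofReal_lt_ofReal_iff_of_nonneg (le_of_lt ht)).1 h3
        · rw [indicator_of_notMem (show t ∉ {t : ℝ | ENNReal.ofReal t < y i} from hi), mul_zero]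
          exact zero_le
    _ = _ := lintegral_const_mul' _ _ (by norm_num)

/-- A bounded perturbation raises the rearrangement by at most `Q`, and the weights `2^{-(j+i)}`
against `Q^2` form a geometric series of size `2^{-j}`. This is how the `L_∞` part becomes
negligible far out in the tail. -/
theorem tsum_funDyadic_sq_le_of_le_add {f g : ℝ → ℂ} (hg : AEStronglyMeasurable g volI)
    {Q : ℝ≥0∞} (h : ∀ᵐ x ∂volI, ‖f x‖ₑ ≤ ‖g x‖ₑ + Q) (j : ℕ) :
    ∑' i, funDyadic f (j + i) ^ 2 ≤ 4 * ∫⁻ x, ‖g x‖ₑ ^ 2 ∂volI + 4 * 2⁻¹ ^ j * Q ^ 2 := by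
  have hsq : ∀ a b : ℝ≥0∞, (a + b) ^ 2 ≤ 2 * a ^ 2 + 2 * b ^ 2 := by
    intro a b
    wlog hab : a ≤ b generalizing a b
    · rw [add_comm a, add_comm (2 * a ^ 2)]
      exact this b a (le_of_not_ge hab)
    obtain ⟨d, rfl⟩ := exists_add_of_le hab
    calc (a + (a + d)) ^ 2 = 4 * a ^ 2 + 4 * (a * d) + d ^ 2 := by ring
      _ ≤ 4 * a ^ 2 + 4 * (a * d) + d ^ 2 + d ^ 2 := le_self_add
      _ = _ := by ring
  calc ∑' i, funDyadic f (j + i) ^ 2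
      ≤ ∑' i, (2 * funDyadic g (j + i) ^ 2 + 2 * 2⁻¹ ^ j * Q ^ 2 * 2⁻¹ ^ i) := by
        refine ENNReal.tsum_le_tsum fun i => ?_
        rw [funDyadic_sq, funDyadic_sq]
        calc _ ≤ (2⁻¹ : ℝ≥0∞) ^ (j + i) * (funRearr g ((1 / 2) ^ (j + i)) + Q) ^ 2 := by
              gcongr; exact funRearr_le_add h _
          _ ≤ (2⁻¹ : ℝ≥0∞) ^ (j + i) *
              (2 * funRearr g ((1 / 2) ^ (j + i)) ^ 2 + 2 * Q ^ 2) := by gcongr; exact hsq _ _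
          _ = _ := by rw [pow_add]; ring
    _ = 2 * ∑' i, funDyadic g (j + i) ^ 2 + 4 * 2⁻¹ ^ j * Q ^ 2 := by
        rw [ENNReal.tsum_add, ENNReal.tsum_mul_left, ENNReal.tsum_mul_left,
          ENNReal.tsum_geometric, ENNReal.one_sub_inv_two, inv_inv]
        ring
    _ ≤ 2 * ∑' i, funDyadic g i ^ 2 + 4 * 2⁻¹ ^ j * Q ^ 2 := by
        gcongr ?_ + _
        exact mul_le_mul_right (ENNReal.tsum_comp_le_tsum_of_injective
          (add_right_injective j) (fun i => funDyadic g i ^ 2)) _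
    _ ≤ 2 * (2 * ∫⁻ x, ‖g x‖ₑ ^ 2 ∂volI) + 4 * 2⁻¹ ^ j * Q ^ 2 := by
        gcongr; exact tsum_funDyadic_sq_le hg
    _ = _ := by ring

/-! Orthonormal series. -/

theorem Orthonormal.summable_smul_and_enorm_tsum_sq_le {E ι : Type*} [NormedAddCommGroup E]
    [InnerProductSpace ℂ E] [CompleteSpace E] {φ : ι → E} (hφ : Orthonormal ℂ φ) (b : ι → ℂ)
    (hb : ∑' n, ‖b n‖ₑ ^ 2 ≠ ∞) :
    Summable (fun n => b n • φ n) ∧ ‖∑' n, b n • φ n‖ₑ ^ 2 ≤ ∑' n, ‖b n‖ₑ ^ 2 := by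
  have hs : Summable (fun n => ‖b n‖ ^ 2) := by
    have := ENNReal.summable_toReal hb
    simpa using this
  have hsum : Summable (fun n => b n • φ n) := by
    have := (hφ.orthogonalFamily.summable_iff_norm_sq_summable b).2 (by simpa using hs)
    simpa using this
  refine ⟨hsum, ?_⟩
  have hfin : ∀ s : Finset ι, ‖∑ n ∈ s, b n • φ n‖ₑ ^ 2 ≤ ∑' n, ‖b n‖ₑ ^ 2 := by
    intro s
    have h1 := hφ.orthogonalFamily.norm_sum b s
    have h2 : ‖∑ n ∈ s, b n • φ n‖ ^ 2 = ∑ n ∈ s, ‖b n‖ ^ 2 := by simpa using h1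
    have h3 : ‖∑ n ∈ s, b n • φ n‖ₑ ^ 2 = ∑ n ∈ s, ‖b n‖ₑ ^ 2 := by
      simp_rw [← ofReal_norm, ← ENNReal.ofReal_pow (norm_nonneg _)]
      rw [h2, ENNReal.ofReal_sum_of_nonneg fun _ _ => by positivity]
    rw [h3]
    exact ENNReal.sum_le_tsum s
  have hlim : Filter.Tendsto (fun s : Finset ι => ‖∑ n ∈ s, b n • φ n‖ₑ ^ 2) Filter.atTop
      (nhds (‖∑' n, b n • φ n‖ₑ ^ 2)) :=
    ((ENNReal.continuous_pow 2).comp continuous_enorm).continuousAt.tendsto.comp hsum.hasSum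
  exact le_of_tendsto' hlim hfin

theorem ae_enorm_sum_smul_le {ι : Type*} (φ : ι → Lp ℂ 2 volI) {M : ℝ≥0∞}
    (hM : ∀ n, eLpNorm (φ n) ∞ volI ≤ M) (b : ι → ℂ) (s : Finset ι) :
    ∀ᵐ x ∂volI, ‖(∑ n ∈ s, b n • φ n : Lp ℂ 2 volI) x‖ₑ ≤ M * ∑ n ∈ s, ‖b n‖ₑ := by
  classical
  induction s using Finset.induction_on with
  | empty =>
    simp only [Finset.sum_empty]
    filter_upwards [Lp.coeFn_zero ℂ 2 volI] with x hx
    rw [hx]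
    simp
  | insert n s hn ih =>
    rw [Finset.sum_insert hn, Finset.sum_insert hn]
    filter_upwards [ih, Lp.coeFn_add (b n • φ n) (∑ n ∈ s, b n • φ n), Lp.coeFn_smul (b n) (φ n),
      ae_le_eLpNormEssSup (f := φ n) (μ := volI)] with x h1 h2 h3 h4
    rw [h2, Pi.add_apply, h3, Pi.smul_apply, mul_add]
    refine (enorm_add_le _ _).trans (add_le_add ?_ h1)
    rw [enorm_smul, mul_comm]
    gcongr
    exact h4.trans (by simpa [eLpNorm_exponent_top] using hM n)

theorem lintegral_enorm_sq_eq (g : Lp ℂ 2 volI) : ∫⁻ x, ‖g x‖ₑ ^ 2 ∂volI = ‖g‖ₑ ^ 2 := by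
  rw [Lp.enorm_def, eLpNorm_eq_lintegral_rpow_enorm_toReal (by norm_num) (by norm_num)]
  simp only [ENNReal.toReal_ofNat]
  rw [ennreal_sq_sqrt]
  simp

/-- The square tails of the dyadic sequence of the sum of an orthonormal series, in terms of the
dyadic sequence of its coefficients. -/
theorem orthonormal_series_dyadic_le {ι : Type*} {φ : ι → Lp ℂ 2 volI} (hφ : Orthonormal ℂ φ)
    {M : ℝ≥0∞} (hM : ∀ n, eLpNorm (φ n) ∞ volI ≤ M) (c : ι → ℂ)
    (hT : ∑' i, seqDyadic c i ^ 2 ≠ ∞) :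
    Summable (fun n => c n • φ n) ∧ ∀ J j : ℕ,
      ∑' i, funDyadic (invFourier φ c) (j + i) ^ 2 ≤ 8 * ∑' i, seqDyadic c (J + i) ^ 2 +
        4 * 2⁻¹ ^ j *
          (M * (2 * ∑ i ∈ Finset.range J, 2 ^ ((1 / 2 : ℝ) * i) * seqDyadic c i)) ^ 2 := by
  classical
  have hT2 : ∀ J, 2 * ∑' i, seqDyadic c (J + i) ^ 2 ≠ ∞ := fun J =>
    ENNReal.mul_ne_top (by norm_num) (ne_top_of_le_ne_top hT
      (ENNReal.tsum_comp_le_tsum_of_injective (add_right_injective J) fun i => seqDyadic c i ^ 2))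
  have hlow : ∀ J, ∑' n, ‖(upperLevel c J)ᶜ.indicator c n‖ₑ ^ 2 ≤
      2 * ∑' i, seqDyadic c (J + i) ^ 2 := by
    intro J
    refine le_of_eq_of_le (tsum_congr fun n => ?_) (tsum_lowerLevel_sq_le c hT J)
    by_cases hn : n ∈ (upperLevel c J)ᶜ
    · rw [indicator_of_mem hn, indicator_of_mem hn]
    · rw [indicator_of_notMem hn, indicator_of_notMem hn]; simp
  have hsum : Summable (fun n => c n • φ n) := by
    -- At `J = 0` no coefficient is removed, so the lower part is c itself.
    have h0 := (hφ.summable_smul_and_enorm_tsum_sq_le _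
      (ne_top_of_le_ne_top (hT2 0) (hlow 0))).1
    simpa [upperLevel_zero] using h0
  refine ⟨hsum, fun J j => ?_⟩
  obtain ⟨hs1, hn1⟩ := hφ.summable_smul_and_enorm_tsum_sq_le _
      (ne_top_of_le_ne_top (hT2 J) (hlow J))
  -- `g` carries the small coefficients and is measured in `L_2`; `g'` carries the finitely many
  -- large ones and is measured in `L_∞`.
  set g : Lp ℂ 2 volI := ∑' n, (upperLevel c J)ᶜ.indicator c n • φ n with hg
  set s := (finite_upperLevel c J).toFinset with hs
  set g' : Lp ℂ 2 volI := ∑ n ∈ s, c n • φ n with hg'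
  have hfin : HasSum (fun n => (upperLevel c J).indicator c n • φ n) g' := by
    have h1 : g' = ∑ n ∈ s, (upperLevel c J).indicator c n • φ n := by
      refine Finset.sum_congr rfl fun n hn => ?_
      rw [indicator_of_mem ((finite_upperLevel c J).mem_toFinset.1 hn)]
    rw [h1]
    refine hasSum_sum_of_ne_finset_zero fun n hn => ?_
    rw [indicator_of_notMem (fun h => hn ((finite_upperLevel c J).mem_toFinset.2 h)), zero_smul]
  have hsplit : invFourier φ c = g + g' := by
    have h1 := hs1.hasSum.add hfin
    refine HasSum.tsum_eq ?_
    convert h1 using 2 with n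
    rw [← add_smul, ← Pi.add_apply, indicator_compl_add_self]
  set Q := M * (2 * ∑ i ∈ Finset.range J, 2 ^ ((1 / 2 : ℝ) * i) * seqDyadic c i) with hQ
  have hQle : M * ∑ n ∈ s, ‖c n‖ₑ ≤ Q := by
    rw [hQ]
    refine mul_le_mul_right (le_trans ?_ (tsum_upperLevel_le c J)) _
    refine le_trans (le_of_eq ?_) (ENNReal.sum_le_tsum s)
    refine Finset.sum_congr rfl fun n hn => ?_
    rw [indicator_of_mem ((finite_upperLevel c J).mem_toFinset.1 hn)]
  have hae : ∀ᵐ x ∂volI, ‖(invFourier φ c : ℝ → ℂ) x‖ₑ ≤ ‖g x‖ₑ + Q := by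
    rw [hsplit]
    filter_upwards [ae_enorm_sum_smul_le φ hM c s, Lp.coeFn_add g g'] with x h1 h2
    rw [h2, Pi.add_apply]
    exact (enorm_add_le _ _).trans (add_le_add le_rfl (h1.trans hQle))
  refine (tsum_funDyadic_sq_le_of_le_add (Lp.aestronglyMeasurable g) hae j).trans ?_
  rw [lintegral_enorm_sq_eq]
  gcongr ?_ + _
  calc 4 * ‖g‖ₑ ^ 2 ≤ 4 * (2 * ∑' i, seqDyadic c (J + i) ^ 2) := by
        gcongr; exact hn1.trans (hlow J)
    _ = _ := by ring

/-! ### Elementary inequalities for the dependence on the uniform bound -/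

theorem rpow_le_rpow_mul_exp {x s t : ℝ} (hx : 0 ≤ x) (hs : 0 ≤ s) (ht : 0 < t) :
    x ^ s ≤ t ^ s * Real.exp (x / t * s) := by
  have h1 : x / t ≤ Real.exp (x / t) := by linarith [Real.add_one_le_exp (x / t)]
  have h2 : (x / t) ^ s ≤ Real.exp (x / t * s) := by
    rw [Real.exp_mul]
    exact Real.rpow_le_rpow (by positivity) h1 hs
  calc x ^ s = t ^ s * (x / t) ^ s := by
        rw [← Real.mul_rpow ht.le (by positivity)]; congr 1; field_simp
    _ ≤ _ := by gcongr

theorem one_add_log_rpow_le_mul_self {γ : ℝ} (hγ : 0 < γ) :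
    ∃ C : ℝ, 1 ≤ C ∧ ∀ M : ℝ, 1 ≤ M →
      (1 + Real.log M) ^ γ ≤ C * min M ((1 + Real.log M) ^ γ) := by
  refine ⟨1 + γ ^ γ * Real.exp 1, by linarith [show 0 < γ ^ γ * Real.exp 1 by positivity],
    fun M hM => ?_⟩
  have hL : 0 ≤ Real.log M := Real.log_nonneg hM
  have hp : 0 < γ ^ γ * Real.exp 1 := by positivity
  have hLγ : 0 ≤ (1 + Real.log M) ^ γ := by positivity
  rcases min_cases M ((1 + Real.log M) ^ γ) with ⟨h, _⟩ | ⟨h, _⟩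
  · rw [h]
    have := rpow_le_rpow_mul_exp (x := 1 + Real.log M) (by linarith) hγ.le hγ
    rw [div_mul_cancel₀ _ hγ.ne', Real.exp_add, Real.exp_log (by linarith)] at this
    nlinarith
  · rw [h]; nlinarith

/-- If `M^2 ≤ 2^{x/2}`, then `M^2 2^{-x} ≤ 2^{-x/2}`, and exponential decay beats `x^{-2γ}`.
Otherwise `x < 4 log M / log 2 < 6 (1 + log M)`, and the right side already exceeds 1. -/
theorem min_one_sq_mul_two_rpow_le {γ : ℝ} (hγ : 0 < γ) :
    ∃ C : ℝ, 0 < C ∧ ∀ M x : ℝ, 1 ≤ M → 1 ≤ x →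
      min 1 (M ^ 2 * 2 ^ (-x)) ≤ (C * ((1 + Real.log M) / x) ^ γ) ^ 2 := by
  have l2 : 0 < Real.log 2 := Real.log_pos (by norm_num)
  -- Chosen so that `exp (γ x / t) = 2^{x/4}`.
  set t : ℝ := 4 * γ / Real.log 2 with ht
  have ht0 : 0 < t := by positivity
  refine ⟨6 ^ γ + t ^ γ, by positivity, fun M x hM hx => ?_⟩
  have hL : 0 ≤ Real.log M := Real.log_nonneg hM
  have hx0 : 0 < x := by linarith
  have hLγ : 0 ≤ ((1 + Real.log M) / x) ^ γ := by positivity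
  have h6 : (0 : ℝ) < 6 ^ γ := by positivity
  have htγ : 0 < t ^ γ := by positivity
  by_cases h : M ^ 2 ≤ 2 ^ (x / 2)
  · refine (min_le_right _ _).trans ?_
    have h1 : M ^ 2 * 2 ^ (-x) ≤ (2 ^ (-(x / 4)) : ℝ) ^ 2 := by
      calc M ^ 2 * 2 ^ (-x) ≤ 2 ^ (x / 2) * 2 ^ (-x) := by gcongr
        _ = _ := by
          rw [← Real.rpow_natCast, ← Real.rpow_mul (by norm_num), ← Real.rpow_add (by norm_num)]
          congr 1; push_cast; ring
    refine h1.trans ?_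
    gcongr
    have h2 := rpow_le_rpow_mul_exp hx0.le hγ.le ht0
    have h3 : Real.exp (x / t * γ) = 2 ^ (x / 4) := by
      rw [Real.rpow_def_of_pos (by norm_num)]; congr 1; rw [ht]; field_simp
    rw [h3] at h2
    have h4 : (2 : ℝ) ^ (-(x / 4)) ≤ t ^ γ * (1 / x) ^ γ := by
      rw [Real.rpow_neg (by norm_num), Real.div_rpow (by norm_num) hx0.le, Real.one_rpow,
        mul_one_div, ← one_div, div_le_div_iff₀ (by positivity) (by positivity)]
      linarith
    refine h4.trans ?_
    have h5 : (1 / x) ^ γ ≤ ((1 + Real.log M) / x) ^ γ := by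
      gcongr
      linarith
    nlinarith
  · push Not at h
    refine (min_le_left _ _).trans ?_
    have h1 := Real.log_lt_log (by positivity) h
    rw [Real.log_rpow (by norm_num), Real.log_pow] at h1
    have h2 : (1 : ℝ) ≤ 6 * ((1 + Real.log M) / x) := by
      rw [mul_div_assoc', le_div_iff₀ hx0]
      have := Real.log_two_gt_d9
      push_cast at h1
      nlinarith
    have h3 : (1 : ℝ) ≤ 6 ^ γ * ((1 + Real.log M) / x) ^ γ := by
      rw [← Real.mul_rpow (by norm_num) (by positivity)]
      exact Real.one_le_rpow h2 hγ.le
    have h4 : (1 : ℝ) ≤ (6 ^ γ + t ^ γ) * ((1 + Real.log M) / x) ^ γ := by nlinarith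
    nlinarith

/-! ### Block norms of the series -/

/-- The sequence `(0, U 0, U 1, …)`. -/
def shiftRight (U : ℕ → ℝ≥0∞) : ℕ → ℝ≥0∞
  | 0 => 0
  | l + 1 => U l

theorem eLpNorm_shiftRight_le {q : ℝ≥0∞} (U : ℕ → ℝ≥0∞) :
    eLpNorm (shiftRight U) q Measure.count ≤ eLpNorm U q Measure.count := by
  rcases eq_or_ne q 0 with rfl | h0
  · simp
  rcases eq_or_ne q ∞ with rfl | ht
  · simp only [eLpNorm_exponent_top, eLpNormEssSup_count, enorm_eq_self]
    refine iSup_le fun l => ?_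
    cases l with
    | zero => exact zero_le
    | succ l => exact le_iSup U l
  · have hq : 0 < q.toReal := ENNReal.toReal_pos h0 ht
    simp only [eLpNorm_eq_lintegral_rpow_enorm_toReal h0 ht, lintegral_count, enorm_eq_self]
    rw [tsum_eq_zero_add' ENNReal.summable]
    simp [shiftRight, hq]

/-- The square root of the tail of the squares. -/
noncomputable def sqTail (A : ℕ → ℝ≥0∞) (l : ℕ) : ℝ≥0∞ := (∑' d : ℕ, A (l + d) ^ 2) ^ (1 / 2 : ℝ)

theorem sqTail_sq (A : ℕ → ℝ≥0∞) (l : ℕ) : sqTail A l ^ 2 = ∑' d : ℕ, A (l + d) ^ 2 :=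
  ennreal_sq_sqrt _

theorem le_of_ennreal_sq_le {x y : ℝ≥0∞} (h : x ^ 2 ≤ y ^ 2) : x ≤ y :=
  le_of_not_gt fun h' => not_le.2 (ENNReal.pow_lt_pow_left (by norm_num) h') h

/-- The block norms of an orthonormal series, with the dependence on the uniform bound. -/
theorem blockNorm_orthonormal_series_le {γ : ℝ} (hγ : 0 < γ) :
    ∃ C : ℝ≥0∞, C ≠ ∞ ∧ ∀ {ι : Type} {φ : ι → Lp ℂ 2 volI} {M : ℝ} (c : ι → ℂ),
      Orthonormal ℂ φ → 1 ≤ M → (∀ n, eLpNorm (φ n) ∞ volI ≤ ENNReal.ofReal M) →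
      sqTail (blockNorm (seqDyadic c)) 0 ≠ ∞ →
      Summable (fun n => c n • φ n) ∧ ∀ l,
        blockNorm (funDyadic (invFourier φ c)) l ≤
          3 * shiftRight (sqTail (blockNorm (seqDyadic c))) l +
          C * ENNReal.ofReal ((1 + Real.log M) ^ γ) * 2 ^ (-γ * l) *
            sqTail (blockNorm (seqDyadic c)) 0 := by
  obtain ⟨C, hC, hmin⟩ := min_one_sq_mul_two_rpow_le hγ
  -- The 3 serves block 0, where the shifted main term vanishes; `2^γ` pays for passing from
  -- `2^{-γl}` to `2^{-γ(l+1)}`.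
  set C' : ℝ≥0∞ := 3 + 17 * ENNReal.ofReal C * 2 ^ γ with hC'
  have hC't : C' ≠ ∞ := by
    rw [hC']
    exact ENNReal.add_ne_top.2 ⟨by norm_num, ENNReal.mul_ne_top
      (ENNReal.mul_ne_top (by norm_num) ENNReal.ofReal_ne_top) (two_rpow_ne_top _)⟩
  refine ⟨C', hC't, fun {ι φ M} c hφ hM1 hM hT => ?_⟩
  set a := seqDyadic c with ha
  set T := sqTail (blockNorm a) with hTdef
  have htail : ∀ l, ∑' i, a (2 ^ l - 1 + i) ^ 2 ≤ T l ^ 2 := fun l => by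
    rw [hTdef, sqTail_sq]; exact tail_le_tsum_blockNorm a l
  have hall : ∑' i, a i ^ 2 ≤ T 0 ^ 2 := by simpa using htail 0
  have ha0 : ∀ i, a i ≤ T 0 := fun i => le_of_ennreal_sq_le ((ENNReal.le_tsum i).trans hall)
  obtain ⟨hsum, hdy⟩ := orthonormal_series_dyadic_le hφ hM c
    (ne_top_of_le_ne_top (ENNReal.pow_ne_top hT) hall)
  refine ⟨hsum, ?_⟩
  set F := blockNorm (funDyadic (invFourier φ c)) with hF
  have hlog : 0 ≤ Real.log M := Real.log_nonneg hM1
  -- The choice `J = 0`: no bounded part, hence no dependence on `M`.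
  have hcrude : ∀ l, F l ^ 2 ≤ 8 * T 0 ^ 2 := fun l => by
    refine (blockNorm_sq_le_tail _ l).trans ((hdy 0 _).trans ?_)
    simp only [Finset.range_zero, Finset.sum_empty, zero_add, mul_zero, ne_eq, OfNat.ofNat_ne_zero,
      not_false_eq_true, zero_pow, add_zero]
    gcongr
  intro l
  cases l with
  | zero =>
    have h1 : F 0 ≤ 3 * T 0 := by
      refine le_of_ennreal_sq_le ((hcrude 0).trans ?_)
      rw [mul_pow]; gcongr; norm_num
    have h2 : (1 : ℝ≥0∞) ≤ ENNReal.ofReal ((1 + Real.log M) ^ γ) := by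
      rw [ENNReal.one_le_ofReal]
      exact Real.one_le_rpow (by linarith) hγ.le
    calc F 0 ≤ 3 * T 0 := h1
      _ ≤ C' * 1 * 1 * T 0 := by
        rw [mul_one, mul_one]; gcongr; exact le_self_add
      _ ≤ C' * ENNReal.ofReal ((1 + Real.log M) ^ γ) * 1 * T 0 := by gcongr
      _ = _ := by simp [shiftRight]
  | succ l =>
    set x : ℝ := 2 ^ l with hx
    have hx1 : 1 ≤ x := one_le_pow₀ (by norm_num)
    set w : ℝ := M ^ 2 * 2 ^ (-x) with hw
    -- The choice `J = 2^l - 1`, `j = 2^(l+1) - 1`: the bounded part contributes `2^{J-j} =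
    -- 2^{-2^l}`. Comparing block `l + 1` of `F` with the tail of `a` from block `l` is the source
    -- of `shiftRight`.
    have hfine : F (l + 1) ^ 2 ≤ 8 * T l ^ 2 + 256 * ENNReal.ofReal w * T 0 ^ 2 := by
      refine (blockNorm_sq_le_tail _ _).trans ((hdy (2 ^ l - 1) _).trans ?_)
      have hs : ∑ i ∈ Finset.range (2 ^ l - 1), (2 : ℝ≥0∞) ^ ((1 / 2 : ℝ) * i) * a i ≤
          4 * 2 ^ ((1 / 2 : ℝ) * (2 ^ l - 1 : ℕ)) * T 0 := by
        calc _ ≤ ∑ i ∈ Finset.range (2 ^ l - 1), (2 : ℝ≥0∞) ^ ((1 / 2 : ℝ) * i) * T 0 := by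
              gcongr with i; exact ha0 i
          _ ≤ _ := by rw [← Finset.sum_mul]; gcongr; exact sum_two_rpow_half_le _
      have hpow : (2⁻¹ : ℝ≥0∞) ^ (2 ^ (l + 1) - 1) * ((2 : ℝ≥0∞) ^ ((1 / 2 : ℝ) *
          (2 ^ l - 1 : ℕ))) ^ 2 = ENNReal.ofReal (2 ^ (-x)) := by
        rw [mul_comm (1 / 2 : ℝ), ENNReal.rpow_mul, ennreal_sq_sqrt, ENNReal.rpow_natCast]
        have e : 2 ^ (l + 1) - 1 = 2 ^ l + (2 ^ l - 1) := by
          have := Nat.one_le_two_pow (n := l); rw [pow_succ]; omega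
        rw [e, pow_add, mul_assoc, ← mul_pow, ENNReal.inv_mul_cancel (by norm_num) (by norm_num),
          one_pow, mul_one, ← ENNReal.ofReal_rpow_of_pos (by norm_num), hx, ENNReal.rpow_neg]
        have : ((2 : ℝ) ^ l) = ((2 ^ l : ℕ) : ℝ) := by push_cast; rfl
        rw [this, ENNReal.rpow_natCast, ENNReal.inv_pow]
        simp
      refine add_le_add (mul_le_mul_right (htail l) _) ?_
      calc _ ≤ 4 * 2⁻¹ ^ (2 ^ (l + 1) - 1) * (ENNReal.ofReal M * (2 *
            (4 * 2 ^ ((1 / 2 : ℝ) * (2 ^ l - 1 : ℕ)) * T 0))) ^ 2 := by gcongr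
        _ = 256 * (ENNReal.ofReal M ^ 2 * ((2⁻¹ : ℝ≥0∞) ^ (2 ^ (l + 1) - 1) *
            ((2 : ℝ≥0∞) ^ ((1 / 2 : ℝ) * (2 ^ l - 1 : ℕ))) ^ 2)) * T 0 ^ 2 := by ring
        _ = _ := by
          rw [hpow, ← ENNReal.ofReal_pow (by linarith), ← ENNReal.ofReal_mul (by positivity)]
    set z : ℝ≥0∞ := ENNReal.ofReal (C * ((1 + Real.log M) / x) ^ γ) with hz
    have hmin' : F (l + 1) ^ 2 ≤ 8 * T l ^ 2 + 264 * z ^ 2 * T 0 ^ 2 := by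
      have h1 : ENNReal.ofReal (min 1 w) ≤ z ^ 2 := by
        rw [hz, ← ENNReal.ofReal_pow (by positivity)]
        exact ENNReal.ofReal_le_ofReal (hmin M x hM1 hx1)
      rcases min_cases 1 w with ⟨h, _⟩ | ⟨h, _⟩
      · rw [h, ENNReal.ofReal_one] at h1
        calc F (l + 1) ^ 2 ≤ 8 * T 0 ^ 2 := hcrude _
          _ ≤ 264 * 1 * T 0 ^ 2 := by gcongr; norm_num
          _ ≤ 264 * z ^ 2 * T 0 ^ 2 := by gcongr
          _ ≤ _ := le_add_self
      · rw [h] at h1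
        calc F (l + 1) ^ 2 ≤ _ := hfine
          _ ≤ 8 * T l ^ 2 + 264 * z ^ 2 * T 0 ^ 2 := by gcongr; norm_num
    -- Here `8 ≤ 3^2` and `264 ≤ 17^2`; the cross term is nonnegative.
    have h3 : F (l + 1) ≤ 3 * T l + 17 * z * T 0 := by
      refine le_of_ennreal_sq_le (hmin'.trans ?_)
      calc 8 * T l ^ 2 + 264 * z ^ 2 * T 0 ^ 2 ≤ 9 * T l ^ 2 + 289 * z ^ 2 * T 0 ^ 2 := by
            gcongr <;> norm_num
        _ ≤ 9 * T l ^ 2 + 289 * z ^ 2 * T 0 ^ 2 + 102 * T l * z * T 0 := le_self_add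
        _ = _ := by ring
    refine h3.trans (add_le_add le_rfl (mul_le_mul_left ?_ _))
    have hz2 : z = ENNReal.ofReal C * ENNReal.ofReal ((1 + Real.log M) ^ γ) * 2 ^ (-γ * l) := by
      have hxl : (ENNReal.ofReal (x ^ γ))⁻¹ = 2 ^ (-γ * l) := by
        rw [← ENNReal.ofReal_rpow_of_pos (by positivity), hx, ENNReal.ofReal_pow (by norm_num),
          ← ENNReal.rpow_natCast, ← ENNReal.rpow_mul, ← ENNReal.rpow_neg]
        congr 1
        · simp
        · ring
      rw [hz, Real.div_rpow (by linarith) (by linarith), ENNReal.ofReal_mul hC.le,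
        div_eq_mul_inv, ENNReal.ofReal_mul (by positivity), ← mul_assoc,
        ENNReal.ofReal_inv_of_pos (by positivity), hxl]
    have hg : (2 : ℝ≥0∞) ^ (-γ * l) = 2 ^ γ * 2 ^ (-γ * ((l + 1 : ℕ) : ℝ)) := by
      rw [← two_rpow_add]; congr 1; push_cast; ring
    calc 17 * z = 17 * ENNReal.ofReal C * 2 ^ γ * ENNReal.ofReal ((1 + Real.log M) ^ γ) *
          2 ^ (-γ * ((l + 1 : ℕ) : ℝ)) := by rw [hz2, hg]; ring
      _ ≤ _ := by gcongr; exact le_add_self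

theorem recip_min_add_recip_max (q : ℝ≥0∞) :
    recip (min q 2) + recip (max q 2) = recip q + recip 2 := by
  rcases le_total q 2 with h | h
  · rw [min_eq_left h, max_eq_right h]
  · rw [min_eq_right h, max_eq_left h, add_comm]

/-- Weighted `ℓ_q` bound for the block norms of an orthonormal series. -/
theorem eLpNorm_weighted_blockNorm_series_le {q : ℝ≥0∞} {α ε : ℝ} (hq : 0 < q)
    (hα : -recip q < α) (hε : 0 < ε) :
    ∃ C : ℝ≥0∞, C ≠ ∞ ∧ ∀ {ι : Type} {φ : ι → Lp ℂ 2 volI} {M : ℝ} (c : ι → ℂ),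
      Orthonormal ℂ φ → 1 ≤ M → (∀ n, eLpNorm (φ n) ∞ volI ≤ ENNReal.ofReal M) →
      seqLZNorm 2 q (α + recip (min q 2)) c < ∞ →
      Summable (fun n => c n • φ n) ∧
        eLpNorm (fun l : ℕ => (2 : ℝ≥0∞) ^ ((α + recip q) * l) *
          blockNorm (funDyadic (invFourier φ c)) l) q Measure.count ≤
        C * ENNReal.ofReal ((1 + Real.log M) ^ (α + ε + recip q)) *
          seqLZNorm 2 q (α + recip (min q 2)) c := by
  set δ := α + recip q with hδ
  have hδ0 : 0 < δ := by linarith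
  set b := α + recip (min q 2) with hb
  have hγ : 0 < α + ε + recip q := by linarith
  obtain ⟨C1, hC1, h1⟩ := eLpNorm_seqDyadic_le hq.ne' b
  obtain ⟨C2, hC2, h2⟩ := eLpNorm_blockNorm_le hq.ne' b
  obtain ⟨C3, hC3, h3⟩ := eLpNorm_weighted_tail_le hδ0 hq.ne'
  obtain ⟨C4, hC4, h4⟩ := blockNorm_orthonormal_series_le hγ
  -- The shift `1/min(q,2)` in the source space exactly compensates the loss from `l_q` to `l_2` on
  -- blocks.
  have he : b - recip 2 + recip (max 2 q) = δ := by
    have := recip_min_add_recip_max q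
    rw [max_comm]; linarith
  rw [he] at h2
  -- The error decays like `2^{-(δ+ε)l}` against the weight `2^{δl}`, leaving `2^{-εl}`; this is the
  -- only place where `ε` is spent.
  set r : ℝ≥0∞ := 2 ^ (-ε) with hr
  have hr1 : r < 1 := two_rpow_neg_lt_one hε
  set G := eLpNorm (fun l : ℕ => r ^ l) q Measure.count with hG
  have hGt : G ≠ ∞ := eLpNorm_geometric_ne_top hr1 hq.ne'
  set B : ℝ≥0∞ := C3 * (C2 * C1) with hB
  have hBt : B ≠ ∞ := ENNReal.mul_ne_top hC3 (ENNReal.mul_ne_top hC2 hC1)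
  set P : ℝ≥0∞ := ENNReal.LpAddConst q with hP
  have hPt : P ≠ ∞ := (ENNReal.LpAddConst_lt_top q).ne
  refine ⟨P * (3 * 2 ^ δ * B + C4 * G * B), ENNReal.mul_ne_top hPt (ENNReal.add_ne_top.2
    ⟨ENNReal.mul_ne_top (ENNReal.mul_ne_top (by norm_num) (two_rpow_ne_top _)) hBt,
      ENNReal.mul_ne_top (ENNReal.mul_ne_top hC4 hGt) hBt⟩), fun {ι φ M} c hφ hM1 hM hK => ?_⟩
  set K := seqLZNorm 2 q b c with hKdef
  set A := blockNorm (seqDyadic c) with hA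
  set U : ℕ → ℝ≥0∞ := fun l => 2 ^ (δ * l) * sqTail A l with hU
  have hUK : eLpNorm U q Measure.count ≤ B * K := by
    calc eLpNorm U q Measure.count ≤ C3 * (C2 * (C1 * K)) :=
          (h3 A).trans (mul_le_mul_right ((h2 _).trans (mul_le_mul_right (h1 c) _)) _)
      _ = _ := by rw [hB]; ring
  -- `sqTail A 0` is the term of `U` at `l = 0`, whose weight is 1.
  have hT0 : sqTail A 0 ≤ B * K := by
    refine le_trans ?_ hUK
    simpa [hU] using enorm_le_eLpNorm_count U 0 hq.ne'
  obtain ⟨hsum, hF⟩ := h4 c hφ hM1 hM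
    (ne_top_of_le_ne_top (ENNReal.mul_ne_top hBt hK.ne) hT0)
  refine ⟨hsum, ?_⟩
  set F := blockNorm (funDyadic (invFourier φ c)) with hFdef
  set Λ := ENNReal.ofReal ((1 + Real.log M) ^ (α + ε + recip q)) with hΛ
  have hΛ1 : 1 ≤ Λ := by
    rw [hΛ, ENNReal.one_le_ofReal]
    exact Real.one_le_rpow (by linarith [Real.log_nonneg hM1]) hγ.le
  have hpt : ∀ l : ℕ, (2 : ℝ≥0∞) ^ (δ * l) * F l ≤
      3 * 2 ^ δ * shiftRight U l + C4 * Λ * sqTail A 0 * r ^ l := by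
    intro l
    refine (mul_le_mul_right (hF l) _).trans (le_of_eq ?_)
    rw [mul_add]
    congr 1
    · cases l with
      | zero => simp [shiftRight]
      | succ l =>
        have : (2 : ℝ≥0∞) ^ (δ * ((l + 1 : ℕ) : ℝ)) = 2 ^ δ * 2 ^ (δ * l) := by
          rw [← two_rpow_add]; congr 1; push_cast; ring
        simp only [shiftRight, hU]
        rw [this]; ring
    · have : r ^ l = (2 : ℝ≥0∞) ^ (δ * l) * 2 ^ (-(α + ε + recip q) * l) := by
        rw [hr, ← two_rpow_mul_pow, ← two_rpow_add]; congr 1; rw [hδ]; ring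
      rw [this]; ring
  have hc1 : (3 : ℝ≥0∞) * 2 ^ δ ≠ ∞ := ENNReal.mul_ne_top (by norm_num) (two_rpow_ne_top _)
  have hc2 : C4 * Λ * sqTail A 0 ≠ ∞ := ENNReal.mul_ne_top (ENNReal.mul_ne_top hC4
    ENNReal.ofReal_ne_top) (ne_top_of_le_ne_top (ENNReal.mul_ne_top hBt hK.ne) hT0)
  calc _ ≤ eLpNorm ((fun l => 3 * 2 ^ δ * shiftRight U l) +
        fun l => C4 * Λ * sqTail A 0 * r ^ l) q Measure.count :=
        eLpNorm_mono_enorm fun l => by simpa using hpt l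
    _ ≤ P * (eLpNorm (fun l => 3 * 2 ^ δ * shiftRight U l) q Measure.count +
        eLpNorm (fun l => C4 * Λ * sqTail A 0 * r ^ l) q Measure.count) :=
        eLpNorm_add_le' Measurable.of_discrete.aestronglyMeasurable
          Measurable.of_discrete.aestronglyMeasurable q
    _ ≤ P * (3 * 2 ^ δ * (B * K) + C4 * Λ * (B * K) * G) := by
        rw [eLpNorm_const_mul_ennreal _ _ hc1, eLpNorm_const_mul_ennreal _ _ hc2]
        gcongr
        exact (eLpNorm_shiftRight_le U).trans hUK
    _ ≤ P * (3 * 2 ^ δ * (B * K) * Λ + C4 * Λ * (B * K) * G) := by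
        refine mul_le_mul_right (add_le_add ?_ le_rfl) _
        exact le_mul_of_one_le_right' hΛ1
    _ = _ := by ring

/-! ### Return to the function spaces and conclusion -/

/-- On a probability space the `L_2` norm, here 1, is at most the `L_∞` norm. -/
theorem one_le_of_orthonormal_bounded {ι : Type} [Nonempty ι] {φ : ι → Lp ℂ 2 volI} {M : ℝ}
    (hφ : Orthonormal ℂ φ) (hM : ∀ n, eLpNorm (φ n) ∞ volI ≤ ENNReal.ofReal M) : 1 ≤ M := by
  obtain ⟨n⟩ := ‹Nonempty ι›
  rw [← ENNReal.one_le_ofReal]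
  have h1 : eLpNorm (φ n) 2 volI = 1 := by
    rw [← Lp.enorm_def, ← ofReal_norm, hφ.norm_eq_one n, ENNReal.ofReal_one]
  have h2 := eLpNorm_le_eLpNorm_mul_rpow_measure_univ (μ := volI) (p := 2) (q := ∞) le_top
    (Lp.aestronglyMeasurable (φ n))
  rw [h1] at h2
  refine (h2.trans (le_of_eq ?_)).trans (hM n)
  simp

theorem orthonormal_series_lorentzZygmund {q : ℝ≥0∞} {α ε : ℝ} (hq : 0 < q)
    (hα : -recip q < α) (hε : 0 < ε) :
    ∃ C : ℝ, 0 < C ∧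
      ∀ (ι : Type) [Infinite ι] (φ : ι → Lp ℂ 2 volI) (M : ℝ),
        Orthonormal ℂ φ →
        (⨆ n, eLpNorm (φ n) ∞ volI) = ENNReal.ofReal M →
        ∀ c ∈ seqLZ ι 2 q (α + recip (min q 2)),
          Summable (fun n => c n • φ n) ∧
          (invFourier φ c : ℝ → ℂ) ∈
            funLZ 2 q (α + recip (max q 2)) ∩ funLZ 2 (max q 2) (α + recip q) ∧
          max (funLZNorm 2 q (α + recip (max q 2)) (invFourier φ c))
              (funLZNorm 2 (max q 2) (α + recip q) (invFourier φ c)) ≤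
            ENNReal.ofReal (C * min M ((1 + Real.log M) ^ |α + ε + recip q|)) *
              seqLZNorm 2 q (α + recip (min q 2)) c := by
  have hγ : 0 < α + ε + recip q := by linarith
  obtain ⟨C1, hC1, h1⟩ := eLpNorm_weighted_blockNorm_series_le hq hα hε
  obtain ⟨C2, hC2, h2⟩ := funLZNorm_le_eLpNorm_funDyadic q (α + recip (max q 2))
  obtain ⟨C3, hC3, h3⟩ := eLpNorm_le_blockNorm q (α + recip (max q 2))
  obtain ⟨C4, hC4, h4⟩ := funLZNorm_le_eLpNorm_funDyadic (max q 2) (α + recip q)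
  obtain ⟨C5, hC5, h5⟩ := eLpNorm_le_blockNorm (max q 2) (α + recip q)
  obtain ⟨C6, hC6, h6⟩ := one_add_log_rpow_le_mul_self hγ
  -- Both target spaces lead to the same block weight `α + 1/q`; the second is measured in
  -- `l_{max(q,2)}`, which the `l_q` norm dominates.
  have e3 : α + recip (max q 2) + recip q - recip (max q 2) = α + recip q := by ring
  have e5 : α + recip q + recip (max q 2) - recip (max (max q 2) 2) = α + recip q := by
    rw [max_eq_left (le_max_right q 2)]; ring
  rw [e3] at h3
  rw [e5] at h5
  set D : ℝ≥0∞ := (C2 * C3 + C4 * C5) * C1 with hD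
  have hDt : D ≠ ∞ := ENNReal.mul_ne_top (ENNReal.add_ne_top.2
    ⟨ENNReal.mul_ne_top hC2 hC3, ENNReal.mul_ne_top hC4 hC5⟩) hC1
  have hD0 : 0 ≤ D.toReal := ENNReal.toReal_nonneg
  refine ⟨(D.toReal + 1) * C6, by positivity, fun ι _ φ M hφ hM c hc => ?_⟩
  have hMn : ∀ n, eLpNorm (φ n) ∞ volI ≤ ENNReal.ofReal M := fun n =>
    (le_iSup (fun n => eLpNorm (φ n) ∞ volI) n).trans_eq hM
  have hM1 := one_le_of_orthonormal_bounded hφ hMn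
  have hL : 0 ≤ Real.log M := Real.log_nonneg hM1
  have hK : seqLZNorm 2 q (α + recip (min q 2)) c < ∞ := hc
  obtain ⟨hsum, hmain⟩ := h1 c hφ hM1 hMn hK
  set K := seqLZNorm 2 q (α + recip (min q 2)) c with hKdef
  set Λ := (1 + Real.log M) ^ (α + ε + recip q) with hΛ
  set N := eLpNorm (fun l : ℕ => (2 : ℝ≥0∞) ^ ((α + recip q) * l) *
          blockNorm (funDyadic (invFourier φ c)) l) q Measure.count with hN
  have n1 : funLZNorm 2 q (α + recip (max q 2)) (invFourier φ c) ≤ C2 * C3 * N := by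
    rw [mul_assoc]
    exact (h2 _).trans (mul_le_mul_right (h3 _) _)
  have n2 : funLZNorm 2 (max q 2) (α + recip q) (invFourier φ c) ≤ C4 * C5 * N := by
    rw [mul_assoc]
    refine (h4 _).trans (mul_le_mul_right ((h5 _).trans (mul_le_mul_right ?_ _)) _)
    exact eLpNorm_count_le_of_exponent_le hq.ne' (le_max_left _ _) _
  have n3 : (C2 * C3 + C4 * C5) * N ≤
      ENNReal.ofReal ((D.toReal + 1) * C6 * min M ((1 + Real.log M) ^ |α + ε + recip q|)) *
        K := by
    rw [abs_of_pos hγ]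
    calc (C2 * C3 + C4 * C5) * N ≤ (C2 * C3 + C4 * C5) * (C1 * ENNReal.ofReal Λ * K) := by
          gcongr
      _ = ENNReal.ofReal (D.toReal * Λ) * K := by
          rw [ENNReal.ofReal_mul hD0, ENNReal.ofReal_toReal hDt, hD]; ring
      _ ≤ _ := by
          refine mul_le_mul_left (ENNReal.ofReal_le_ofReal ?_) _
          have hΛ0 : 0 ≤ Λ := by positivity
          rw [mul_assoc]
          exact mul_le_mul (by linarith) (h6 M hM1) hΛ0 (by linarith)
  have m1 := (n1.trans (mul_le_mul_left le_self_add N)).trans n3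
  have m2 := (n2.trans (mul_le_mul_left le_add_self N)).trans n3
  have hfin := ENNReal.mul_lt_top (ENNReal.ofReal_lt_top (r := (D.toReal + 1) * C6 *
    min M ((1 + Real.log M) ^ |α + ε + recip q|))) hK
  exact ⟨hsum, ⟨⟨Lp.aestronglyMeasurable _, m1.trans_lt hfin⟩,
    ⟨Lp.aestronglyMeasurable _, m2.trans_lt hfin⟩⟩, max_le m1 m2⟩

theorem corollary4p2 :
    (∀ (q : ℝ≥0∞) (α ε : ℝ), 0 < q → -recip q < α → 0 < ε →
      ∃ C : ℝ, 0 < C ∧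
        ∀ (ι : Type) [Countable ι] [Infinite ι] (φ : ι → Lp ℂ 2 volI) (M : ℝ),
          Orthonormal ℂ φ →
          (⨆ n, eLpNorm (φ n) ∞ volI) = ENNReal.ofReal M →
          ∀ c ∈ seqLZ ι 2 q (α + recip (min q 2)),
            Summable (fun n => c n • φ n) ∧
            (invFourier φ c : ℝ → ℂ) ∈
              funLZ 2 q (α + recip (max q 2)) ∩ funLZ 2 (max q 2) (α + recip q) ∧
            max (funLZNorm 2 q (α + recip (max q 2)) (invFourier φ c))
                (funLZNorm 2 (max q 2) (α + recip q) (invFourier φ c)) ≤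
              ENNReal.ofReal (C * min M ((1 + Real.log M) ^ |α + ε + recip q|)) *
                seqLZNorm 2 q (α + recip (min q 2)) c) ∧
    (∀ α ε : ℝ, -(1 / 2) < α → 0 < ε →
      ∃ C : ℝ, 0 < C ∧
        ∀ (ι : Type) [Countable ι] [Infinite ι] (φ : ι → Lp ℂ 2 volI) (M : ℝ),
          Orthonormal ℂ φ →
          (⨆ n, eLpNorm (φ n) ∞ volI) = ENNReal.ofReal M →
          ∀ c ∈ seqLZ ι 2 2 (α + 1 / 2),
            Summable (fun n => c n • φ n) ∧
            (invFourier φ c : ℝ → ℂ) ∈ funLZ 2 2 (α + 1 / 2) ∧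
            funLZNorm 2 2 (α + 1 / 2) (invFourier φ c) ≤
              ENNReal.ofReal (C * min M ((1 + Real.log M) ^ |α + ε + 1 / 2|)) *
                seqLZNorm 2 2 (α + 1 / 2) c) := by

  refine ⟨fun q α ε hq hα hε => ?_, fun α ε hα hε => ?_⟩
  · obtain ⟨C, hC, h⟩ := orthonormal_series_lorentzZygmund hq hα hε
    exact ⟨C, hC, fun ι _ _ φ M => h ι φ M⟩
  -- For `q = 2` the two spaces in the intersection coincide.
  · obtain ⟨C, hC, h⟩ := orthonormal_series_lorentzZygmund (q := 2) (α := α) (by norm_num)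
      (by rw [recip_two]; exact hα) hε
    simp only [min_self, max_self, recip_two, inter_self] at h
    exact ⟨C, hC, fun ι _ _ φ M => h ι φ M⟩
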